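/- **Theorem 4.** Let $\mathcal H$ be an infinite-dimensional separable complex Hilbert space, let $\mathcal H\wedge\mathcal H$ be the (completed) antisymmetric tensor product, and let $\mathcal F=\bigoplus_{N\ge 0}\bigwedge^N\mathcal H$ be the fermionic Fock space (Hilbert space direct sum). For an orthonormal basis $\{\varphi_i\}_{i\ge1}$ of $\mathcal H$ and $\mu_1,\dots,\mu_L\in\{0,1\}$ let $\Phi_{\mu_1\dots\mu_L}=\varphi_{i_1}\wedge\dots\wedge\varphi_{i_N}$, where $i_1<\dots<i_N$ are the indices $i$ with $\mu_i=1$. A vector $\Psi\in\mathcal F$ is called a (half-infinite) matrix product state (MPS) with respect to $\{\varphi_i\}$ with bond dimensions $(r_i)_{i\ge1}$ if there are complex $r_{i-1}\times r_i$ matrices $A_i[0],A_i[1]$ ($i\ge1$, $r_0=1$) such that $$\Psi=\lim_{L\to\infty}\ \sum_{\mu_1,\dots,\mu_L=0}^1 A_1[\mu_1]A_2[\mu_2]\cdots A_L[\mu_L]\begin{pmatrix}0\\ \vdots\\ 0\\ 1\end{pmatrix}\Phi_{\mu_1\dots\mu_L}$$ in the norm of $\mathcal F$, where the column vector has length $r_L$.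 For $\Psi\in\mathcal H\wedge\mathcal H$ let $\gamma_\Psi$ be the one-particle reduced density matrix, i.e. the operator on $\mathcal H$ with $\langle g,\gamma_\Psi f\rangle=\langle\Psi,a^\dagger(f)a(g)\Psi\rangle$ for all $f,g\in\mathcal H$, where $a^\dagger$, $a$ are the fermionic creation and annihilation operators. 1. For every $\Psi\in\mathcal H\wedge\mathcal H$ such that $\ker\gamma_\Psi$ is not of finite odd dimension there is an orthonormal basis $\{\varphi_i\}_{i\ge1}$ of $\mathcal H$ consisting of natural orbitals (eigenvectors of $\gamma_\Psi$) with respect to which $\Psi$ is an MPS with bond dimensions $r_1=2$, $r_i=2$ for $i$ even, and $r_i=3$ for $i$ odd and $>1$. If $\ker\gamma_\Psi$ has finite odd dimension, there is such a basis with respect to which $\Psi$ is an MPS with the same bond dimensions shifted by one site, i.e. $(r_1,r_2,r_3,\dots)=(1,2,2,3,2,3,2,\dots)$. In particular, for every $\Psi\in\mathcal H\wedge\mathcal H$ there is an orthonormal basis of natural orbitals and an MPS representation with maximal bond dimension at most $3$. 2. The value $3$ is minimal: there is a $\Psi\in\mathcal H\wedge\mathcal H$ which is not an MPS with bond dimensions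 $r_i\le2$ for all $i$ with respect to any orthonormal basis of $\mathcal H$. -/

import Mathlib

open Filter Topology
open scoped InnerProductSpace

namespace FermionFock

noncomputable section

section ExteriorInner

variable {H : Type*} [NormedAddCommGroup H] [InnerProductSpace ℂ H] {N : ℕ}

/-- The linear functional on the exterior power sending `w₁ ∧ ⋯ ∧ w_N` to `det ⟪v_i, w_j⟫`. -/
def wedgePair (v : Fin N → H) : ⋀[ℂ]^N H →ₗ[ℂ] ℂ :=
  exteriorPower.alternatingMapToDual ℂ H N (fun j => (innerSL ℂ (v j)).toLinearMap)

theorem wedgePair_apply (v w : Fin N → H) :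
    wedgePair v (exteriorPower.ιMulti ℂ N w) = Matrix.det (Matrix.of fun i j => ⟪v j, w i⟫_ℂ) := by
  simp [wedgePair]

/-- For fixed `y`, the alternating map sending `(v₁, …, v_N)` to the complex conjugate of
`⟪v₁ ∧ ⋯ ∧ v_N, y⟫`. -/
def wedgePairConj (y : ⋀[ℂ]^N H) : H [⋀^Fin N]→ₗ[ℂ] ℂ where
  toFun v := starRingEnd ℂ (wedgePair v y)
  map_update_add' v i a b := by
    have h : ∀ c : H, (fun j => (innerSL ℂ (Function.update v i c j)).toLinearMap)
        = Function.update (fun j => (innerSL ℂ (v j)).toLinearMap) i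
          (innerSL ℂ c).toLinearMap := by
      intro c; funext j
      rcases eq_or_ne j i with rfl | hj
      · simp
      · simp [hj]
    simp only [wedgePair]
    rw [h, h, h, map_add, ContinuousLinearMap.toLinearMap_add, AlternatingMap.map_update_add]
    simp
  map_update_smul' v i c a := by
    have h : ∀ c : H, (fun j => (innerSL ℂ (Function.update v i c j)).toLinearMap)
        = Function.update (fun j => (innerSL ℂ (v j)).toLinearMap) i
          (innerSL ℂ c).toLinearMap := by
      intro c; funext j
      rcases eq_or_ne j i with rfl | hj
      · simp
      · simp [hj]
    simp only [wedgePair]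
    rw [h, h, map_smulₛₗ, ContinuousLinearMap.toLinearMap_smul, AlternatingMap.map_update_smul]
    simp
  map_eq_zero_of_eq' v i j hv hij := by
    simp only [wedgePair]
    rw [AlternatingMap.map_eq_zero_of_eq _ _ (by simp [hv]) hij]
    simp

/-- The Hermitian form on the exterior power with
`⟪v₁ ∧ ⋯ ∧ v_N, w₁ ∧ ⋯ ∧ w_N⟫ = det ⟪v_i, w_j⟫` (conjugate-linear in the first argument). -/
def wedgeInner (x y : ⋀[ℂ]^N H) : ℂ :=
  starRingEnd ℂ (exteriorPower.alternatingMapLinearEquiv (wedgePairConj y) x)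

theorem wedgeInner_ιMulti_left (v : Fin N → H) (y : ⋀[ℂ]^N H) :
    wedgeInner (exteriorPower.ιMulti ℂ N v) y = wedgePair v y := by
  simp [wedgeInner, wedgePairConj]

theorem wedgeInner_ιMulti (v w : Fin N → H) :
    wedgeInner (exteriorPower.ιMulti ℂ N v) (exteriorPower.ιMulti ℂ N w)
      = Matrix.det (Matrix.of fun i j => ⟪v i, w j⟫_ℂ) := by
  rw [wedgeInner_ιMulti_left, wedgePair_apply, ← Matrix.det_transpose]
  rfl

theorem wedgeInner_add_left (x x' y : ⋀[ℂ]^N H) :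
    wedgeInner (x + x') y = wedgeInner x y + wedgeInner x' y := by
  simp [wedgeInner]

theorem wedgeInner_smul_left (c : ℂ) (x y : ⋀[ℂ]^N H) :
    wedgeInner (c • x) y = starRingEnd ℂ c * wedgeInner x y := by
  simp [wedgeInner]

theorem exists_sum_ιMulti (x : ⋀[ℂ]^N H) :
    ∃ (s : Finset (Fin N → H)) (c : (Fin N → H) → ℂ),
      x = ∑ v ∈ s, c v • exteriorPower.ιMulti ℂ N v := by
  have hx : x ∈ Submodule.span ℂ (Set.range (exteriorPower.ιMulti ℂ N (M := H))) := by
    rw [exteriorPower.ιMulti_span]; trivial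
  rw [Finsupp.mem_span_range_iff_exists_finsupp] at hx
  obtain ⟨c, rfl⟩ := hx
  exact ⟨c.support, c, rfl⟩

theorem wedgeInner_sum (s t : Finset (Fin N → H)) (c d : (Fin N → H) → ℂ) :
    wedgeInner (∑ v ∈ s, c v • exteriorPower.ιMulti ℂ N v)
      (∑ w ∈ t, d w • exteriorPower.ιMulti ℂ N w)
      = ∑ v ∈ s, ∑ w ∈ t, starRingEnd ℂ (c v) * d w *
          Matrix.det (Matrix.of fun i j => ⟪v i, w j⟫_ℂ) := by
  have h1 : ∀ y : ⋀[ℂ]^N H, wedgeInner (∑ v ∈ s, c v • exteriorPower.ιMulti ℂ N v) y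
      = ∑ v ∈ s, starRingEnd ℂ (c v) * wedgePair v y := by
    intro y
    simp [wedgeInner, wedgePairConj]
  rw [h1]
  refine Finset.sum_congr rfl fun v _ => ?_
  rw [map_sum, Finset.mul_sum]
  refine Finset.sum_congr rfl fun w _ => ?_
  rw [map_smul, ← wedgeInner_ιMulti_left, wedgeInner_ιMulti, smul_eq_mul, mul_assoc]

theorem wedgeInner_conj_symm (x y : ⋀[ℂ]^N H) :
    starRingEnd ℂ (wedgeInner y x) = wedgeInner x y := by
  obtain ⟨s, c, rfl⟩ := exists_sum_ιMulti x
  obtain ⟨t, d, rfl⟩ := exists_sum_ιMulti y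
  rw [wedgeInner_sum, wedgeInner_sum, map_sum, Finset.sum_comm]
  simp_rw [map_sum]
  refine Finset.sum_congr rfl fun w _ => ?_
  refine Finset.sum_congr rfl fun v _ => ?_
  rw [map_mul, map_mul, Complex.conj_conj, mul_comm (d _), RingHom.map_det, ← Matrix.det_transpose]
  congr 2
  ext i j
  simp

/-- A Cauchy-Binet type identity. -/
theorem sum_det_mul_det {ι : Type*} [Fintype ι] [DecidableEq ι] (A B : ι → Fin N → ℂ) :
    ∑ f : Fin N → ι, Matrix.det (Matrix.of fun k j => A (f k) j) *
        Matrix.det (Matrix.of fun k j => B (f k) j)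
      = (N.factorial : ℂ) * Matrix.det (Matrix.of fun i j => ∑ e, A e i * B e j) := by
  have hA : ∀ (A : ι → Fin N → ℂ) (f : Fin N → ι), Matrix.det (Matrix.of fun k j => A (f k) j)
      = ∑ σ : Equiv.Perm (Fin N), ((Equiv.Perm.sign σ : ℤ) : ℂ) * ∏ k, A (f k) (σ k) := by
    intro A f
    rw [← Matrix.det_transpose, Matrix.det_apply']
    rfl
  simp_rw [hA, Finset.sum_mul_sum]
  rw [Finset.sum_comm]
  set G : Matrix (Fin N) (Fin N) ℂ := Matrix.of fun i j => ∑ e, A e i * B e j with hG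
  have key : ∀ σ : Equiv.Perm (Fin N), ∑ f : Fin N → ι, ∑ τ : Equiv.Perm (Fin N),
      ((Equiv.Perm.sign σ : ℤ) : ℂ) * (∏ k, A (f k) (σ k)) *
        (((Equiv.Perm.sign τ : ℤ) : ℂ) * ∏ k, B (f k) (τ k)) = G.det := by
    intro σ
    have h2 : G.det = ((Equiv.Perm.sign σ : ℤ) : ℂ) * (G.submatrix σ id).det := by
      rw [Matrix.det_permute, ← mul_assoc]
      norm_cast
      simp
    rw [h2, ← Matrix.det_transpose, Matrix.det_apply', Finset.mul_sum, Finset.sum_comm]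
    refine Finset.sum_congr rfl fun τ _ => ?_
    have h3 : ∏ k, (G.submatrix σ id).transpose (τ k) k
        = ∑ f : Fin N → ι, ∏ k, (A (f k) (σ k) * B (f k) (τ k)) := by
      simp only [hG, Matrix.transpose_apply, Matrix.submatrix_apply, Matrix.of_apply, id]
      rw [Finset.prod_univ_sum]
      simp
    rw [h3, Finset.mul_sum, Finset.mul_sum]
    refine Finset.sum_congr rfl fun f _ => ?_
    rw [Finset.prod_mul_distrib]
    ring
  rw [Finset.sum_congr rfl fun σ _ => key σ]
  simp [Fintype.card_perm]

theorem wedgeInner_self_nonneg (x : ⋀[ℂ]^N H) : 0 ≤ (wedgeInner x x).re := by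
  classical
  obtain ⟨s, c, rfl⟩ := exists_sum_ιMulti x
  rw [wedgeInner_sum]
  let W : Submodule ℂ H := Submodule.span ℂ (⋃ v ∈ s, Set.range v)
  have : FiniteDimensional ℂ W :=
    FiniteDimensional.span_of_finite ℂ (s.finite_toSet.biUnion fun v _ => Set.finite_range v)
  let e := stdOrthonormalBasis ℂ W
  have hW : ∀ v ∈ s, ∀ i, v i ∈ W := fun v hv i =>
    Submodule.subset_span (Set.mem_biUnion hv ⟨i, rfl⟩)
  have hin : ∀ v ∈ s, ∀ w ∈ s, ∀ i j, ⟪v i, w j⟫_ℂ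
      = ∑ k, starRingEnd ℂ ⟪(e k : H), v i⟫_ℂ * ⟪(e k : H), w j⟫_ℂ := by
    intro v hv w hw i j
    have := e.sum_inner_mul_inner ⟨v i, hW v hv i⟩ ⟨w j, hW w hw j⟩
    simp only [Submodule.coe_inner] at this
    rw [← this]
    simp
  let D : (Fin N → Fin (Module.finrank ℂ W)) → (Fin N → H) → ℂ := fun f v =>
    Matrix.det (Matrix.of fun k j => ⟪(e (f k) : H), v j⟫_ℂ)
  have hdet : ∀ v ∈ s, ∀ w ∈ s, (N.factorial : ℂ) * Matrix.det (Matrix.of fun i j => ⟪v i, w j⟫_ℂ)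
      = ∑ f, starRingEnd ℂ (D f v) * D f w := by
    intro v hv w hw
    have h := sum_det_mul_det (fun k i => starRingEnd ℂ ⟪(e k : H), v i⟫_ℂ)
      (fun k i => ⟪(e k : H), w i⟫_ℂ)
    rw [show (Matrix.of fun i j => ⟪v i, w j⟫_ℂ) = (Matrix.of fun i j =>
      ∑ k, starRingEnd ℂ ⟪(e k : H), v i⟫_ℂ * ⟪(e k : H), w j⟫_ℂ) from by
        ext i j; exact hin v hv w hw i j, ← h]
    refine Finset.sum_congr rfl fun f _ => ?_
    congr 1
    rw [RingHom.map_det]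
    rfl
  have htot : (N.factorial : ℂ) * ∑ v ∈ s, ∑ w ∈ s, starRingEnd ℂ (c v) * c w *
          Matrix.det (Matrix.of fun i j => ⟪v i, w j⟫_ℂ)
      = ((∑ f, Complex.normSq (∑ v ∈ s, c v * D f v) : ℝ) : ℂ) := by
    have : ∀ v ∈ s, ∀ w ∈ s, (N.factorial : ℂ) * (starRingEnd ℂ (c v) * c w *
          Matrix.det (Matrix.of fun i j => ⟪v i, w j⟫_ℂ))
        = ∑ f, starRingEnd ℂ (c v * D f v) * (c w * D f w) := by
      intro v hv w hw
      rw [show ∀ a b d : ℂ, a * (b * d) = b * (a * d) from fun a b d => by ring,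
        hdet v hv w hw, Finset.mul_sum]
      refine Finset.sum_congr rfl fun f _ => ?_
      rw [map_mul]; ring
    rw [Finset.mul_sum]
    simp_rw [Finset.mul_sum]
    rw [Finset.sum_congr rfl fun v hv => Finset.sum_congr rfl fun w hw => this v hv w hw]
    simp_rw [Finset.sum_comm (t := (Finset.univ : Finset (Fin N → Fin (Module.finrank ℂ W))))]
    push_cast
    refine Finset.sum_congr rfl fun f _ => ?_
    rw [Complex.normSq_eq_conj_mul_self, map_sum, Finset.sum_mul_sum]
  have hre := congrArg Complex.re htot
  rw [Complex.ofReal_re, ← Complex.ofReal_natCast, Complex.re_ofReal_mul] at hre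
  have hpos : (0 : ℝ) < N.factorial := by exact_mod_cast N.factorial_pos
  refine nonneg_of_mul_nonneg_right (a := (N.factorial : ℝ)) ?_ hpos
  rw [hre]
  exact Finset.sum_nonneg fun f _ => Complex.normSq_nonneg _

/-- The Gram determinant inner product on the algebraic exterior power. -/
instance instCoreExteriorPower : PreInnerProductSpace.Core ℂ (⋀[ℂ]^N H) where
  inner := wedgeInner
  conj_inner_symm := wedgeInner_conj_symm
  re_inner_nonneg := wedgeInner_self_nonneg
  add_left := wedgeInner_add_left
  smul_left x y c := wedgeInner_smul_left c x y

instance instSeminormedExteriorPower : SeminormedAddCommGroup (⋀[ℂ]^N H) :=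
  InnerProductSpace.Core.toSeminormedAddCommGroup (𝕜 := ℂ)

instance instInnerExteriorPower : InnerProductSpace ℂ (⋀[ℂ]^N H) :=
  InnerProductSpace.ofCore _

end ExteriorInner

section Fock

variable (H : Type*) [NormedAddCommGroup H] [InnerProductSpace ℂ H]

/-- The Hilbert space `H ∧ ⋯ ∧ H` (`N` factors): the completion of the algebraic exterior power
with respect to the Gram determinant inner product. -/
abbrev AntisymPower (N : ℕ) : Type _ := UniformSpace.Completion (⋀[ℂ]^N H)

/-- The fermionic Fock space: the Hilbert space direct sum over `N` of the `N`-fold antisymmetric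
products of `H`. -/
abbrev FockSpace : Type _ := lp (fun N : ℕ => AntisymPower H N) 2

variable {H}

/-- The antisymmetric product `v₁ ∧ ⋯ ∧ v_N`. For orthonormal `v_i` it has norm one. -/
def wedge {N : ℕ} (v : Fin N → H) : AntisymPower H N :=
  ((exteriorPower.ιMulti ℂ N v : ⋀[ℂ]^N H) : UniformSpace.Completion (⋀[ℂ]^N H))

theorem inner_wedge {N : ℕ} (v w : Fin N → H) :
    ⟪wedge v, wedge w⟫_ℂ = Matrix.det (Matrix.of fun i j => ⟪v i, w j⟫_ℂ) := by
  rw [wedge, wedge, UniformSpace.Completion.inner_coe]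
  exact wedgeInner_ιMulti v w

/-- The inclusion of the `N`-particle space into Fock space. -/
def inSector (N : ℕ) (Ψ : AntisymPower H N) : FockSpace H := lp.single 2 N Ψ

/-- The Slater determinant with occupation numbers `μ₁, …, μ_L` in the orthonormal basis `φ`: the
antisymmetric product, in increasing order, of the `φ i` with `μ i = 1` (sites counted from `0`).
If no site is occupied, it is the vacuum. -/
def slater (φ : HilbertBasis ℕ ℂ H) {L : ℕ} (μ : Fin L → Fin 2) : FockSpace H :=
  let S : Finset (Fin L) := Finset.univ.filter fun i => μ i = 1
  inSector S.card (wedge fun k => φ (S.orderEmbOfFin rfl k))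

/-- The bond dimensions `r₀ = 1, r₁, r₂, …`; the value `r 0` is ignored. -/
def bond (r : ℕ → ℕ) : ℕ → ℕ
  | 0 => 1
  | i + 1 => r (i + 1)

/-- The product `A₁[μ₁] A₂[μ₂] ⋯ A_L[μ_L]`, a row of length `r_L`. Here `A i` is the tensor at
the `(i + 1)`-st site, a matrix of size `r_i × r_{i+1}` for either occupation number. -/
def tensorProd {r : ℕ → ℕ}
    (A : ∀ i : ℕ, Fin 2 → Matrix (Fin (bond r i)) (Fin (bond r (i + 1))) ℂ) :
    ∀ L : ℕ, (Fin L → Fin 2) → Matrix (Fin 1) (Fin (bond r L)) ℂ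
  | 0, _ => (1 : Matrix (Fin 1) (Fin 1) ℂ)
  | L + 1, μ => tensorProd A L (fun i => μ i.castSucc) * A L (μ (Fin.last L))

/-- The column vector `(0, …, 0, 1)` of length `n`. -/
def lastVec (n : ℕ) : Fin n → ℂ := fun j => if (j : ℕ) + 1 = n then 1 else 0

/-- The finite matrix product state
`∑_{μ₁, …, μ_L} A₁[μ₁] ⋯ A_L[μ_L] (0, …, 0, 1)ᵀ Φ_{μ₁ … μ_L}`. -/
def finiteMPS (φ : HilbertBasis ℕ ℂ H) {r : ℕ → ℕ}
    (A : ∀ i : ℕ, Fin 2 → Matrix (Fin (bond r i)) (Fin (bond r (i + 1))) ℂ) (L : ℕ) :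
    FockSpace H :=
  ∑ μ : Fin L → Fin 2, (tensorProd A L μ).mulVec (lastVec (bond r L)) 0 • slater φ μ

/-- The half-infinite matrix product states with respect to the basis `φ` with bond dimensions
`r 1, r 2, …`: the limits, in the norm of Fock space, of finite matrix product states built from
one fixed sequence of tensors. -/
def halfInfiniteMPS (r : ℕ → ℕ) (φ : HilbertBasis ℕ ℂ H) : Set (FockSpace H) :=
  {Ψ | ∃ A : ∀ i : ℕ, Fin 2 → Matrix (Fin (bond r i)) (Fin (bond r (i + 1))) ℂ,
    Tendsto (fun L => finiteMPS φ A L) atTop (𝓝 Ψ)}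

end Fock

section DensityMatrix

variable {H : Type*} [NormedAddCommGroup H] [InnerProductSpace ℂ H]

theorem inner_wedge_two (f g f' g' : H) :
    ⟪wedge ![f, g], wedge ![f', g']⟫_ℂ = ⟪f, f'⟫_ℂ * ⟪g, g'⟫_ℂ - ⟪f, g'⟫_ℂ * ⟪g, f'⟫_ℂ := by
  rw [inner_wedge, Matrix.det_fin_two]
  simp

theorem norm_wedge_two_le (f g : H) : ‖wedge ![f, g]‖ ≤ ‖f‖ * ‖g‖ := by
  have h : ‖wedge ![f, g]‖ ^ 2 ≤ (‖f‖ * ‖g‖) ^ 2 := by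
    rw [← inner_self_eq_norm_sq (𝕜 := ℂ), inner_wedge_two, map_sub, inner_mul_symm_re_eq_norm,
      inner_self_eq_norm_sq_to_K, inner_self_eq_norm_sq_to_K]
    have h2 : RCLike.re ((‖f‖ : ℂ) ^ 2 * (‖g‖ : ℂ) ^ 2) = (‖f‖ * ‖g‖) ^ 2 := by
      rw [← mul_pow, ← Complex.ofReal_mul, ← Complex.ofReal_pow]
      exact Complex.ofReal_re _
    have h3 := norm_nonneg (⟪f, g⟫_ℂ * ⟪g, f⟫_ℂ)
    exact (sub_le_self _ h3).trans_eq h2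
  exact (sq_le_sq₀ (norm_nonneg _) (by positivity)).1 h

theorem wedge_two_add (f g g' : H) :
    wedge ![f, g + g'] = wedge ![f, g] + wedge ![f, g'] := by
  have h : ∀ x : H, ![f, x] = Function.update ![f, 0] 1 x := fun x => by
    ext i; fin_cases i <;> simp
  rw [wedge, h, AlternatingMap.map_update_add, UniformSpace.Completion.coe_add, ← h, ← h]
  rfl

theorem wedge_two_smul (c : ℂ) (f g : H) : wedge ![f, c • g] = c • wedge ![f, g] := by
  have h : ∀ x : H, ![f, x] = Function.update ![f, 0] 1 x := fun x => by
    ext i; fin_cases i <;> simp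
  rw [wedge, h, AlternatingMap.map_update_smul, UniformSpace.Completion.coe_smul, ← h]
  rfl

theorem wedge_two_swap (f g : H) : wedge ![f, g] = -wedge ![g, f] := by
  have h : ![f, g] = ![g, f] ∘ Equiv.swap (0 : Fin 2) 1 := by
    ext i; fin_cases i <;> simp
  rw [wedge, h, AlternatingMap.map_swap _ _ (by decide), UniformSpace.Completion.coe_neg]
  rfl

/-- The creation operator `a†(f)` from the one-particle space `H` to `H ∧ H`, `g ↦ f ∧ g`. -/
def create (f : H) : H →L[ℂ] AntisymPower H 2 :=
  LinearMap.mkContinuous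
    { toFun := fun g => wedge ![f, g]
      map_add' := fun g g' => wedge_two_add f g g'
      map_smul' := fun c g => wedge_two_smul c f g }
    ‖f‖ (norm_wedge_two_le f)

variable [CompleteSpace H]

/-- The annihilation operator `a(f)` from `H ∧ H` to the one-particle space `H`, the adjoint of
`a†(f)`. -/
def annihilate (f : H) : AntisymPower H 2 →L[ℂ] H := ContinuousLinearMap.adjoint (create f)

theorem inner_annihilate (f g : H) (Ψ : AntisymPower H 2) :
    ⟪g, annihilate f Ψ⟫_ℂ = ⟪wedge ![f, g], Ψ⟫_ℂ :=
  ContinuousLinearMap.adjoint_inner_right _ _ _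

theorem annihilate_add (f f' : H) (Ψ : AntisymPower H 2) :
    annihilate (f + f') Ψ = annihilate f Ψ + annihilate f' Ψ := by
  refine ext_inner_left ℂ fun g => ?_
  rw [inner_add_right, inner_annihilate, inner_annihilate, inner_annihilate, wedge_two_swap,
    wedge_two_swap f, wedge_two_swap f', wedge_two_add, neg_add, inner_add_left]

theorem annihilate_smul (c : ℂ) (f : H) (Ψ : AntisymPower H 2) :
    annihilate (c • f) Ψ = starRingEnd ℂ c • annihilate f Ψ := by
  refine ext_inner_left ℂ fun g => ?_
  rw [inner_smul_right, inner_annihilate, inner_annihilate, wedge_two_swap,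
    wedge_two_swap f, wedge_two_smul, ← smul_neg, inner_smul_left]

/-- The one-particle reduced density matrix `γ_Ψ` of `Ψ ∈ H ∧ H`: the operator on `H` with
`⟪g, γ_Ψ f⟫ = ⟪Ψ, a†(f) a(g) Ψ⟫`, see `inner_densityMatrix`. -/
def densityMatrix (Ψ : AntisymPower H 2) : H →ₗ[ℂ] H where
  toFun f := -annihilate (annihilate f Ψ) Ψ
  map_add' f f' := by rw [annihilate_add, annihilate_add, neg_add]
  map_smul' c f := by
    rw [annihilate_smul, annihilate_smul, Complex.conj_conj, smul_neg, RingHom.id_apply]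

theorem inner_densityMatrix (Ψ : AntisymPower H 2) (f g : H) :
    ⟪g, densityMatrix Ψ f⟫_ℂ = ⟪Ψ, create f (annihilate g Ψ)⟫_ℂ := by
  have h1 : ⟪Ψ, create f (annihilate g Ψ)⟫_ℂ = ⟪annihilate f Ψ, annihilate g Ψ⟫_ℂ :=
    (ContinuousLinearMap.adjoint_inner_left _ _ _).symm
  have h2 : ⟪g, densityMatrix Ψ f⟫_ℂ = -⟪g, annihilate (annihilate f Ψ) Ψ⟫_ℂ :=
    inner_neg_right _ _
  rw [h1, h2, inner_annihilate, inner_annihilate, wedge_two_swap, inner_neg_left, neg_neg]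

/-- All members of the orthonormal basis `φ` are natural orbitals of `Ψ`, that is, eigenvectors
of its one-particle reduced density matrix. -/
def IsNaturalBasis (φ : HilbertBasis ℕ ℂ H) (Ψ : AntisymPower H 2) : Prop :=
  ∀ i, ∃ n : ℝ, densityMatrix Ψ (φ i) = (n : ℂ) • φ i

end DensityMatrix

end

end FermionFock

namespace FermionFock

noncomputable section

/-! A vector `Ψ` of `H ∧ H` is encoded by the antilinear operator `T f = a(f) Ψ` (`pairMap`). It is
compact, satisfies `⟪g, T f⟫ = -⟪f, T g⟫`, determines `Ψ`, and `γ_Ψ = -T²`, so that `ker γ_Ψ = ker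
T`.

Upper bound: if `e` is a unit eigenvector of `T²` with `T e ≠ 0`, then `e ⟂ T e` and `T (T e) = -‖T
e‖² e`. Hence `H` is the closed sum of two-dimensional blocks `e, T e` and of `ker T`
(`mem_orthogonal_iff_of_maximal`). The kernel vectors are grouped into pairs as well, with
coefficient zero; if the kernel has finite odd dimension, the one left over occupies the first site.
With `p ∈ {0, 1}` leftover vectors this gives `Ψ = ∑ c k • φ (p + 2k) ∧ φ (p + 2k + 1)` in natural
orbitals with eigenvalues `(c k)²` (`exists_hilbertBasis_pairs`, `hasSum_pairs`). A finite automaton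
generates the partial sums. Between pairs it remembers "nothing yet" or "pair complete", inside a
pair also "half a pair"; this accounts for the bond dimensions two and three
(`finiteMPS_eq_sum_pairs`).

Lower bound: bond dimension two makes all minors of order three of the coefficient matrix vanish
across every cut, and this survives the limit (`det_inner_slaterSet_eq_zero`). Sorted by the number
of particles on the left, the minors of a two-particle state become conditions on the antisymmetric
matrix `⟪φ j, T (φ i)⟫`. They confine the range of `T` to four dimensions, in whatever basis
(`exists_span_four_of_mem_halfInfiniteMPS`). Three disjoint pairs have a six-dimensional range. -/

theorem isCompactOperator_inner_smul {H : Type*} [NormedAddCommGroup H]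
    [InnerProductSpace ℂ H] (u v : H) : IsCompactOperator fun f : H => ⟪f, u⟫_ℂ • v := by
  have h1 : IsCompactOperator fun z : ℂ => z • v :=
    isCompactOperator_of_locallyCompactSpace_rng (ContinuousLinearMap.toSpanSingleton ℂ v)
  have h2 : Continuous fun f : H => ⟪f, u⟫_ℂ := by fun_prop
  obtain ⟨K, hK, hK0⟩ := h1
  refine ⟨K, hK, ?_⟩
  have h3 := h2.tendsto 0
  rw [inner_zero_left] at h3
  exact h3 hK0

/-! ### The antilinear operator of a two-particle vector. -/

section PairMap

variable {H : Type*} [NormedAddCommGroup H] [InnerProductSpace ℂ H] [CompleteSpace H]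

theorem norm_annihilate_le (f : H) (Ψ : AntisymPower H 2) : ‖annihilate f Ψ‖ ≤ ‖Ψ‖ * ‖f‖ := by
  have h : ‖create f‖ ≤ ‖f‖ := LinearMap.mkContinuous_norm_le _ (norm_nonneg _) _
  calc ‖annihilate f Ψ‖ ≤ ‖annihilate f‖ * ‖Ψ‖ := ContinuousLinearMap.le_opNorm _ _
    _ = ‖create f‖ * ‖Ψ‖ := by rw [annihilate, LinearIsometryEquiv.norm_map]
    _ ≤ ‖f‖ * ‖Ψ‖ := by gcongr
    _ = ‖Ψ‖ * ‖f‖ := mul_comm _ _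

/-- The antilinear operator `f ↦ a(f) Ψ` on the one-particle space. -/
def pairMap (Ψ : AntisymPower H 2) : H →L⋆[ℂ] H :=
  LinearMap.mkContinuous
    { toFun := fun f => annihilate f Ψ
      map_add' := fun f f' => annihilate_add f f' Ψ
      map_smul' := fun c f => annihilate_smul c f Ψ }
    ‖Ψ‖ (fun f => norm_annihilate_le f Ψ)

theorem pairMap_apply (Ψ : AntisymPower H 2) (f : H) : pairMap Ψ f = annihilate f Ψ := rfl

theorem inner_pairMap (Ψ : AntisymPower H 2) (f g : H) :
    ⟪g, pairMap Ψ f⟫_ℂ = ⟪wedge ![f, g], Ψ⟫_ℂ :=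
  inner_annihilate f g Ψ

theorem inner_pairMap_swap (Ψ : AntisymPower H 2) (f g : H) :
    ⟪g, pairMap Ψ f⟫_ℂ = -⟪f, pairMap Ψ g⟫_ℂ := by
  rw [inner_pairMap, inner_pairMap, wedge_two_swap, inner_neg_left]

theorem densityMatrix_apply (Ψ : AntisymPower H 2) (f : H) :
    densityMatrix Ψ f = -pairMap Ψ (pairMap Ψ f) := rfl

theorem pairMap_add (Ψ Ψ' : AntisymPower H 2) : pairMap (Ψ + Ψ') = pairMap Ψ + pairMap Ψ' := by
  ext f; simp [pairMap_apply]

theorem pairMap_smul (c : ℂ) (Ψ : AntisymPower H 2) : pairMap (c • Ψ) = c • pairMap Ψ := by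
  ext f; simp [pairMap_apply]

theorem norm_pairMap_le (Ψ : AntisymPower H 2) : ‖pairMap Ψ‖ ≤ ‖Ψ‖ :=
  LinearMap.mkContinuous_norm_le _ (norm_nonneg _) _

theorem continuous_pairMap : Continuous (pairMap : AntisymPower H 2 → H →L⋆[ℂ] H) := by
  let L : AntisymPower H 2 →ₗ[ℂ] H →L⋆[ℂ] H :=
    { toFun := pairMap, map_add' := pairMap_add, map_smul' := pairMap_smul }
  exact (L.mkContinuous 1 (fun Ψ => (norm_pairMap_le Ψ).trans_eq (one_mul _).symm)).continuous

theorem pairMap_wedge (u v f : H) :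
    pairMap (wedge ![u, v]) f = ⟪f, u⟫_ℂ • v - ⟪f, v⟫_ℂ • u := by
  refine ext_inner_left ℂ fun g => ?_
  rw [inner_pairMap, inner_wedge_two, inner_sub_right, inner_smul_right, inner_smul_right]

/-- Finite sums of wedges give operators of finite rank. They are dense, `pairMap` is continuous,
and compact operators are closed in norm. -/
theorem isCompactOperator_pairMap (Ψ : AntisymPower H 2) : IsCompactOperator (pairMap Ψ) := by
  induction Ψ using UniformSpace.Completion.induction_on with
  | hp => exact isClosed_setOfPred_isCompactOperator.preimage continuous_pairMap
  | ih x =>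
    obtain ⟨s, c, rfl⟩ := exists_sum_ιMulti x
    let E : ⋀[ℂ]^2 H →ₗ[ℂ] H →L⋆[ℂ] H :=
      { toFun := fun y => pairMap (y : AntisymPower H 2)
        map_add' := fun y z => by rw [UniformSpace.Completion.coe_add, pairMap_add]
        map_smul' := fun a y => by rw [UniformSpace.Completion.coe_smul, pairMap_smul]; rfl }
    change E (∑ v ∈ s, c v • exteriorPower.ιMulti ℂ 2 v) ∈ compactOperator (starRingEnd ℂ) H H
    rw [map_sum]
    refine Submodule.sum_mem _ fun v _ => ?_
    rw [map_smul]
    refine Submodule.smul_mem _ _ ?_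
    have h : E (exteriorPower.ιMulti ℂ 2 v) = pairMap (wedge ![v 0, v 1]) := by
      change pairMap (wedge v) = _
      congr 2
      ext i; fin_cases i <;> rfl
    rw [h]
    have h2 : (pairMap (wedge ![v 0, v 1]) : H → H)
        = (fun f => ⟪f, v 0⟫_ℂ • v 1) - fun f => ⟪f, v 1⟫_ℂ • v 0 := by
      ext f; rw [pairMap_wedge]; rfl
    change IsCompactOperator _
    rw [h2]
    exact (isCompactOperator_inner_smul _ _).sub (isCompactOperator_inner_smul _ _)

/-- Skew symmetry gives `⟪f, γ f⟫ = ‖T f‖²`. -/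
theorem densityMatrix_eq_zero_iff (Ψ : AntisymPower H 2) (f : H) :
    densityMatrix Ψ f = 0 ↔ pairMap Ψ f = 0 := by
  constructor
  · intro h
    have h1 : ⟪f, densityMatrix Ψ f⟫_ℂ = 0 := by rw [h, inner_zero_right]
    rw [densityMatrix_apply, inner_neg_right, inner_pairMap_swap, neg_neg] at h1
    exact inner_self_eq_zero.1 h1
  · intro h
    rw [densityMatrix_apply, h, map_zero, neg_zero]

/-- A two-particle vector is determined by its antilinear operator. -/
theorem pairMap_injective : Function.Injective (pairMap : AntisymPower H 2 → H →L⋆[ℂ] H) := by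
  intro Ψ Ψ' h
  refine ext_inner_left ℂ fun x => ?_
  induction x using UniformSpace.Completion.induction_on with
  | hp => exact isClosed_eq (by fun_prop) (by fun_prop)
  | ih x =>
    obtain ⟨s, c, rfl⟩ := exists_sum_ιMulti x
    have hs : ((∑ v ∈ s, c v • exteriorPower.ιMulti ℂ 2 v : ⋀[ℂ]^2 H) : AntisymPower H 2)
        = ∑ v ∈ s, c v • wedge ![v 0, v 1] := by
      change UniformSpace.Completion.toComplL (𝕜 := ℂ) _ = _
      rw [map_sum]
      refine Finset.sum_congr rfl fun v _ => ?_
      rw [map_smul]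
      congr 1
    rw [hs, sum_inner, sum_inner]
    refine Finset.sum_congr rfl fun v _ => ?_
    rw [inner_smul_left, inner_smul_left, ← inner_pairMap, ← inner_pairMap, h]

end PairMap

/-! ### Canonical form of a compact skew antilinear operator. -/

section Pairing

variable {H : Type*} [NormedAddCommGroup H] [InnerProductSpace ℂ H]

/-- The defining property of a family of Schmidt vectors of the antilinear operator `T`: it is
orthonormal, consists of eigenvectors of `T²`, and stays orthonormal when the (normalized) images
under `T` are added. -/
structure IsPairSet (T : H →L⋆[ℂ] H) (S : Set H) : Prop where
  norm_eq_one : ∀ e ∈ S, ‖e‖ = 1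
  map_ne_zero : ∀ e ∈ S, T e ≠ 0
  exists_eigenvalue : ∀ e ∈ S, ∃ c : ℂ, T (T e) = c • e
  inner_eq_zero : ∀ e ∈ S, ∀ f ∈ S, e ≠ f → ⟪e, f⟫_ℂ = 0
  inner_map_eq_zero : ∀ e ∈ S, ∀ f ∈ S, ⟪e, T f⟫_ℂ = 0

/-- Zorn applies because each condition involves at most two members, and two members of the union
of a chain lie in a common set of the chain. -/
theorem exists_maximal_isPairSet (T : H →L⋆[ℂ] H) : ∃ S, Maximal (IsPairSet T) S := by
  refine zorn_subset {S | IsPairSet T S} fun C hC hchain => ⟨⋃₀ C, ?_, fun s hs =>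
    Set.subset_sUnion_of_mem hs⟩
  have two : ∀ e ∈ ⋃₀ C, ∀ f ∈ ⋃₀ C, ∃ s ∈ C, e ∈ s ∧ f ∈ s := by
    rintro e ⟨s, hs, hes⟩ f ⟨t, ht, hft⟩
    rcases hchain.total hs ht with h | h
    · exact ⟨t, ht, h hes, hft⟩
    · exact ⟨s, hs, hes, h hft⟩
  constructor
  · rintro e ⟨s, hs, he⟩; exact (hC hs).norm_eq_one e he
  · rintro e ⟨s, hs, he⟩; exact (hC hs).map_ne_zero e he
  · rintro e ⟨s, hs, he⟩; exact (hC hs).exists_eigenvalue e he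
  · intro e he f hf hef
    obtain ⟨s, hs, hes, hfs⟩ := two e he f hf
    exact (hC hs).inner_eq_zero e hes f hfs hef
  · intro e he f hf
    obtain ⟨s, hs, hes, hfs⟩ := two e he f hf
    exact (hC hs).inner_map_eq_zero e hes f hfs

variable {T : H →L⋆[ℂ] H}

theorem inner_self_map_eq_zero (hT : ∀ f g, ⟪g, T f⟫_ℂ = -⟪f, T g⟫_ℂ)
    (f : H) : ⟪f, T f⟫_ℂ = 0 := by
  have := hT f f
  linear_combination this / 2

theorem inner_map_map (hT : ∀ f g, ⟪g, T f⟫_ℂ = -⟪f, T g⟫_ℂ)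
    (f g : H) : ⟪T f, T g⟫_ℂ = -⟪g, T (T f)⟫_ℂ := hT g (T f)

/-- Pairing `T (T e) = c • e` with the unit vector `e` leaves no choice for `c`. -/
theorem IsPairSet.map_map (hT : ∀ f g, ⟪g, T f⟫_ℂ = -⟪f, T g⟫_ℂ)
    {S : Set H} (hS : IsPairSet T S) {e : H} (he : e ∈ S) :
    T (T e) = -((‖T e‖ : ℂ) ^ 2) • e := by
  obtain ⟨c, hc⟩ := hS.exists_eigenvalue e he
  have h := inner_map_map hT e e
  rw [hc, inner_smul_right, inner_self_eq_norm_sq_to_K, inner_self_eq_norm_sq_to_K,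
    hS.norm_eq_one e he] at h
  rw [hc]
  congr 1
  simp at h
  rw [h, neg_neg]

/-- The orthonormal family consisting of the members `e` of `S` and of `T e / ‖T e‖`. -/
def pairFamily (T : H →L⋆[ℂ] H) (S : Set H) : S × Fin 2 → H := fun x =>
  if x.2 = 0 then x.1 else (‖T x.1‖⁻¹ : ℂ) • T x.1

theorem IsPairSet.orthonormal (hT : ∀ f g, ⟪g, T f⟫_ℂ = -⟪f, T g⟫_ℂ)
    {S : Set H} (hS : IsPairSet T S) :
    Orthonormal ℂ (pairFamily T S) := by
  constructor
  · rintro ⟨e, i⟩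
    fin_cases i
    · simpa [pairFamily] using hS.norm_eq_one e e.2
    · have := norm_ne_zero_iff.2 (hS.map_ne_zero e e.2)
      simp [pairFamily, norm_smul, this]
  · rintro ⟨e, i⟩ ⟨f, j⟩ hne
    have h1 := hS.inner_map_eq_zero e e.2 f f.2
    have h2 : ⟪T e, (f : H)⟫_ℂ = 0 := by
      rw [← inner_conj_symm, hS.inner_map_eq_zero f f.2 e e.2, map_zero]
    have h3 : e ≠ f → ⟪(e : H), f⟫_ℂ = 0 := fun h =>
      hS.inner_eq_zero e e.2 f f.2 (fun h' => h (Subtype.ext h'))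
    have h4 : e ≠ f → ⟪T e, T f⟫_ℂ = 0 := fun h => by
      rw [inner_map_map hT, hS.map_map hT e.2, inner_smul_right,
        hS.inner_eq_zero f f.2 e e.2 (fun h' => h (Subtype.ext h').symm), mul_zero, neg_zero]
    fin_cases i <;> fin_cases j
    · simpa [pairFamily] using h3 (by rintro rfl; exact hne rfl)
    · simp [pairFamily, inner_smul_right, h1]
    · simp [pairFamily, inner_smul_left, h2]
    · simp [pairFamily, inner_smul_left, inner_smul_right, h4 (by rintro rfl; exact hne rfl)]

theorem IsPairSet.mem_orthogonal_iff {S : Set H} (hS : IsPairSet T S) (w : H) :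
    w ∈ (Submodule.span ℂ (Set.range (pairFamily T S)))ᗮ ↔
      ∀ e ∈ S, ⟪e, w⟫_ℂ = 0 ∧ ⟪T e, w⟫_ℂ = 0 := by
  constructor
  · intro h e he
    have h0 := h _ (Submodule.subset_span ⟨(⟨e, he⟩, 0), rfl⟩)
    have h1 := h _ (Submodule.subset_span ⟨(⟨e, he⟩, 1), rfl⟩)
    refine ⟨by simpa [pairFamily] using h0, ?_⟩
    simpa [pairFamily, inner_smul_left, hS.map_ne_zero e he] using h1
  · intro h
    rw [Submodule.mem_orthogonal]
    intro u hu
    induction hu using Submodule.span_induction with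
    | mem x hx =>
      obtain ⟨⟨e, i⟩, rfl⟩ := hx
      fin_cases i
      · simpa [pairFamily] using (h e e.2).1
      · simp [pairFamily, inner_smul_left, (h e e.2).2]
    | zero => simp
    | add x y _ _ hx hy => rw [inner_add_left, hx, hy, add_zero]
    | smul a x _ hx => rw [inner_smul_left, hx, mul_zero]

/-- The span of the pairs is invariant under `T`, hence by skew symmetry so is its complement. This
allows a new pair to be sought inside the complement. -/
theorem IsPairSet.map_mem_orthogonal (hT : ∀ f g, ⟪g, T f⟫_ℂ = -⟪f, T g⟫_ℂ)
    {S : Set H} (hS : IsPairSet T S) {w : H}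
    (hw : w ∈ (Submodule.span ℂ (Set.range (pairFamily T S)))ᗮ) :
    T w ∈ (Submodule.span ℂ (Set.range (pairFamily T S)))ᗮ := by
  rw [hS.mem_orthogonal_iff] at hw ⊢
  intro e he
  have h1 : ⟪w, e⟫_ℂ = 0 := by rw [← inner_conj_symm, (hw e he).1, map_zero]
  have h2 : ⟪w, T e⟫_ℂ = 0 := by rw [← inner_conj_symm, (hw e he).2, map_zero]
  constructor
  · rw [hT, h2, neg_zero]
  · rw [inner_map_map hT, hS.map_map hT he, inner_smul_right, h1, mul_zero, neg_zero]

theorem IsPairSet.insert (hT : ∀ f g, ⟪g, T f⟫_ℂ = -⟪f, T g⟫_ℂ)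
    {S : Set H} (hS : IsPairSet T S) {u : H} (hu : ‖u‖ = 1) (hTu : T u ≠ 0)
    (hc : ∃ c : ℂ, T (T u) = c • u)
    (hw : u ∈ (Submodule.span ℂ (Set.range (pairFamily T S)))ᗮ) : IsPairSet T (insert u S) := by
  have hw' := (hS.mem_orthogonal_iff _).1 (hS.map_mem_orthogonal hT hw)
  rw [hS.mem_orthogonal_iff] at hw
  constructor
  · rintro e (rfl | he); exacts [hu, hS.norm_eq_one e he]
  · rintro e (rfl | he); exacts [hTu, hS.map_ne_zero e he]
  · rintro e (rfl | he); exacts [hc, hS.exists_eigenvalue e he]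
  · rintro e (rfl | he) f (rfl | hf) hef
    · exact absurd rfl hef
    · rw [← inner_conj_symm, (hw f hf).1, map_zero]
    · exact (hw e he).1
    · exact hS.inner_eq_zero e he f hf hef
  · rintro e (rfl | he) f (rfl | hf)
    · exact inner_self_map_eq_zero hT _
    · rw [← inner_conj_symm, (hw f hf).2, map_zero]
    · exact (hw' e he).1
    · exact hS.inner_map_eq_zero e he f hf

/-- The restriction of `-T²` to the complement of a family of pairs has no nonzero eigenvalue if
the family is maximal, and thus vanishes. -/
theorem mem_orthogonal_iff_of_maximal [CompleteSpace H]
    (hT : ∀ f g, ⟪g, T f⟫_ℂ = -⟪f, T g⟫_ℂ)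
    (hcomp : IsCompactOperator T) {S : Set H}
    (hS : Maximal (IsPairSet T) S) (w : H) :
    w ∈ (Submodule.span ℂ (Set.range (pairFamily T S)))ᗮ ↔ T w = 0 := by
  set W := (Submodule.span ℂ (Set.range (pairFamily T S)))ᗮ with hW
  constructor
  · intro hw
    -- The square of an antilinear map is linear, so the spectral theorem for compact symmetric
    -- operators applies to it.
    let G : H →L[ℂ] H := T.comp T
    have hG : ∀ x ∈ W, G x ∈ W := fun x hx =>
      hS.prop.map_mem_orthogonal hT (hS.prop.map_mem_orthogonal hT hx)
    have hGc : IsCompactOperator G := hcomp.comp_clm T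
    let R : W →L[ℂ] W := G.restrict hG
    have hRc : IsCompactOperator R := hGc.restrict' hG
    have hRs : R.IsSymmetric := by
      intro x y
      change ⟪T (T (x : H)), (y : H)⟫_ℂ = ⟪(x : H), T (T (y : H))⟫_ℂ
      have h1 := inner_map_map hT (x : H) (y : H)
      have h2 := inner_map_map hT (y : H) (x : H)
      rw [← inner_conj_symm, show ⟪(y : H), T (T (x : H))⟫_ℂ = -⟪T (x : H), T (y : H)⟫_ℂ by
        rw [h1, neg_neg], map_neg, inner_conj_symm, h2, neg_neg]
    have hR : R = 0 := by
      rw [← ContinuousLinearMap.eq_zero_of_forall_hasEigenvalue_eq_zero hRc hRs]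
      intro μ hμ
      obtain ⟨v, hv⟩ := hμ.exists_hasEigenvector
      by_contra hne
      have hv1 : T (T (v : H)) = μ • (v : H) := congrArg Subtype.val hv.apply_eq_smul
      have hv0 : (v : H) ≠ 0 := fun h => hv.2 (Subtype.ext h)
      have hTv : T (v : H) ≠ 0 := fun h => by
        rw [h, map_zero] at hv1
        exact smul_ne_zero hne hv0 hv1.symm
      have hvn : (‖(v : H)‖⁻¹ : ℂ) ≠ 0 := by simpa using hv0
      set u : H := (‖(v : H)‖⁻¹ : ℂ) • (v : H) with hu
      have huW : u ∈ W := W.smul_mem _ v.2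
      have hu1 : ‖u‖ = 1 := by
        simp [hu, norm_smul, norm_ne_zero_iff.2 hv0]
      have hTu : T u ≠ 0 := by
        rw [hu, map_smulₛₗ]; exact smul_ne_zero (by simpa using hv0) hTv
      have hTTu : T (T u) = μ • u := by
        rw [hu, map_smulₛₗ, map_smulₛₗ, hv1, smul_comm]; simp
      -- By maximality the eigenvector `u` already belongs to `S`; being orthogonal to all of `S`,
      -- it is orthogonal to itself.
      have hmem := hS.2 (hS.prop.insert hT hu1 hTu ⟨μ, hTTu⟩ huW) (Set.subset_insert u S)
        (Set.mem_insert u S)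
      have := ((hS.prop.mem_orthogonal_iff u).1 huW u hmem).1
      rw [inner_self_eq_zero] at this
      rw [this, norm_zero] at hu1
      exact zero_ne_one hu1
    have hTT : T (T w) = 0 := by
      change ((R ⟨w, hw⟩ : W) : H) = 0
      rw [hR]; rfl
    have := inner_map_map hT w w
    rw [hTT, inner_zero_right, neg_zero] at this
    exact inner_self_eq_zero.1 this
  · intro hw
    rw [hS.prop.mem_orthogonal_iff]
    intro e he
    have h1 : ⟪T e, w⟫_ℂ = 0 := by
      rw [← inner_conj_symm, hT, hw, inner_zero_right, neg_zero, map_zero]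
    have h2 : ⟪T (T e), w⟫_ℂ = 0 := by
      rw [← inner_conj_symm, hT, hw, inner_zero_right, neg_zero, map_zero]
    refine ⟨?_, h1⟩
    rw [hS.prop.map_map hT he, inner_smul_left] at h2
    simpa [hS.prop.map_ne_zero e he] using h2

end Pairing

/-! ### Counting and pairing of index sets. -/

section Indexing

/-- `Nat.card` is `0` on infinite types, which therefore split into pairs without remainder. -/
theorem exists_equiv_fin_sum_prod (κ : Type*) [Countable κ] :
    ∃ κ' : Set ℕ, Nonempty (κ ≃ Fin (Nat.card κ % 2) ⊕ κ' × Fin 2) := by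
  rcases finite_or_infinite κ with h | h
  · refine ⟨Set.Iio (Nat.card κ / 2), ⟨?_⟩⟩
    have e1 : Set.Iio (Nat.card κ / 2) ≃ Fin (Nat.card κ / 2) := Fin.equivSubtype.symm
    refine (Finite.equivFin κ).trans ((finCongr (Nat.mod_add_div (Nat.card κ) 2).symm).trans ?_)
    refine finSumFinEquiv.symm.trans (Equiv.sumCongr (Equiv.refl _) ?_)
    refine (finCongr (mul_comm _ _)).trans (finProdFinEquiv.symm.trans ?_)
    exact e1.symm.prodCongr (Equiv.refl _)
  · refine ⟨Set.univ, ?_⟩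
    obtain ⟨e⟩ := nonempty_equiv_of_countable (α := κ) (β := ℕ)
    have : IsEmpty (Fin (Nat.card κ % 2)) := by
      rw [Nat.card_eq_zero_of_infinite, Nat.zero_mod]; infer_instance
    exact ⟨(e.trans (Nat.divModEquiv 2)).trans (((Equiv.Set.univ ℕ).symm.prodCongr
      (Equiv.refl _)).trans (Equiv.emptySum _ _).symm)⟩

variable {H : Type*} [NormedAddCommGroup H] [InnerProductSpace ℂ H]

theorem _root_.Orthonormal.countable [TopologicalSpace.SeparableSpace H] {ι : Type*} {v : ι → H}
    (hv : Orthonormal ℂ v) : Countable ι := by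
  refine Pairwise.countable_of_isOpen_disjoint (s := fun i => Metric.ball (v i) (1 / 2)) ?_
    (fun i => Metric.isOpen_ball) (fun i => Metric.nonempty_ball.2 (by norm_num))
  intro i j hij
  refine Metric.ball_disjoint_ball ?_
  have h1 : ‖v i - v j‖ ^ 2 = 2 := by
    rw [@norm_sub_sq ℂ, hv.1, hv.1, hv.2 hij]; norm_num
  rw [dist_eq_norm]
  nlinarith [norm_nonneg (v i - v j)]

/-- In infinite dimension both sides take the default value `0`, so an infinite-dimensional kernel
counts as even. -/
theorem _root_.HilbertBasis.card_eq_finrank [CompleteSpace H] {ι : Type*}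
    (b : HilbertBasis ι ℂ H) : Nat.card ι = Module.finrank ℂ H := by
  rcases finite_or_infinite ι with h | h
  · have := Fintype.ofFinite ι
    rw [Module.finrank_eq_card_basis b.toOrthonormalBasis.toBasis, Nat.card_eq_fintype_card]
  · rw [Nat.card_eq_zero_of_infinite, Module.finrank_of_not_finite]
    intro hf
    exact not_finite_iff_infinite.2 h b.orthonormal.linearIndependent.finite

end Indexing

/-! ### The basis of natural orbitals, ordered in pairs. -/

section NaturalBasis

variable {H : Type*} [NormedAddCommGroup H] [InnerProductSpace ℂ H] [CompleteSpace H]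

theorem exists_hilbertBasis_pairs [TopologicalSpace.SeparableSpace H]
    (hH : ¬ FiniteDimensional ℂ H) {T : H →L⋆[ℂ] H} (hT : ∀ f g, ⟪g, T f⟫_ℂ = -⟪f, T g⟫_ℂ)
    (hcomp : IsCompactOperator T) (p : ℕ)
    (hp : Module.finrank ℂ (LinearMap.ker T.toLinearMap) % 2 = p) :
    ∃ (φ : HilbertBasis ℕ ℂ H) (c : ℕ → ℝ), (∀ i < p, T (φ i) = 0) ∧
      (∀ k, T (φ (p + 2 * k)) = (c k : ℂ) • φ (p + 2 * k + 1)) ∧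
      ∀ k, T (φ (p + 2 * k + 1)) = -(c k : ℂ) • φ (p + 2 * k) := by
  obtain ⟨S, hS⟩ := exists_maximal_isPairSet T
  have hker := mem_orthogonal_iff_of_maximal hT hcomp hS
  set W := (Submodule.span ℂ (Set.range (pairFamily T S)))ᗮ with hW
  have hWker : W = LinearMap.ker T.toLinearMap := by ext w; exact hker w
  obtain ⟨κ, b, -⟩ := exists_hilbertBasis ℂ W
  have hb : Orthonormal ℂ (fun x => (b x : H)) :=
    b.orthonormal.comp_linearIsometry W.subtypeₗᵢ
  have hSo := hS.prop.orthonormal hT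
  have := hb.countable
  have := hSo.countable
  have : Countable S := (Prod.mk_left_injective (0 : Fin 2)).countable (β := S × Fin 2)
  obtain ⟨κ', ⟨eκ⟩⟩ := exists_equiv_fin_sum_prod κ
  rw [b.card_eq_finrank, show Module.finrank ℂ W % 2 = p by rw [hWker, hp]] at eκ
  -- The unpaired kernel vector, if any, is moved to the front; everything else is a set of pairs,
  -- from `S` or from the kernel.
  let e1 : (S × Fin 2) ⊕ κ ≃ Fin p ⊕ (S ⊕ κ') × Fin 2 :=
    (Equiv.sumCongr (Equiv.refl _) eκ).trans <|
      (Equiv.sumAssoc _ _ _).symm.trans <|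
        (Equiv.sumCongr (Equiv.sumComm _ _) (Equiv.refl _)).trans <|
          (Equiv.sumAssoc _ _ _).trans <|
            Equiv.sumCongr (Equiv.refl _) (Equiv.sumProdDistrib _ _ _).symm
  let v : (S × Fin 2) ⊕ κ → H := Sum.elim (pairFamily T S) fun x => (b x : H)
  have hv : Orthonormal ℂ v := by
    refine ⟨?_, ?_⟩
    · rintro (x | x); exacts [hSo.1 x, hb.1 x]
    · rintro (x | x) (y | y) hxy
      · exact hSo.2 (fun h => hxy (congrArg _ h))
      · exact (b y).2 _ (Submodule.subset_span ⟨x, rfl⟩)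
      · exact inner_eq_zero_symm.1 ((b x).2 _ (Submodule.subset_span ⟨y, rfl⟩))
      · exact hb.2 (fun h => hxy (congrArg _ h))
  have hvc : (Submodule.span ℂ (Set.range v))ᗮ = ⊥ := by
    rw [eq_bot_iff]
    intro x hx
    have hxW : x ∈ W := by
      refine Submodule.orthogonal_le (Submodule.span_mono ?_) hx
      rintro _ ⟨y, rfl⟩; exact ⟨Sum.inl y, rfl⟩
    have h0 : (⟨x, hxW⟩ : W) = 0 := by
      refine b.repr.injective (lp.ext (funext fun i => ?_))
      rw [b.repr_apply_apply, map_zero]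
      exact hx _ (Submodule.subset_span ⟨Sum.inr i, rfl⟩)
    exact (Submodule.mem_bot ℂ).2 (congrArg Subtype.val h0)
  -- Infinite dimension of `H` provides infinitely many pairs, which can then be numbered by `ℕ`.
  have hinf : Infinite (S ⊕ κ') := by
    by_contra hfin
    rw [not_infinite_iff_finite] at hfin
    have : Finite ((S × Fin 2) ⊕ κ) := Finite.of_equiv _ e1.symm
    have := Fintype.ofFinite ((S × Fin 2) ⊕ κ)
    refine hH ?_
    exact (HilbertBasis.mkOfOrthogonalEqBot hv hvc).toOrthonormalBasis.toBasis.finiteDimensional_of_finite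
  obtain ⟨e2⟩ := nonempty_equiv_of_countable (α := S ⊕ κ') (β := ℕ)
  let e : (S × Fin 2) ⊕ κ ≃ ℕ := e1.trans <|
    (Equiv.sumCongr (Equiv.refl _) ((e2.prodCongr (Equiv.refl _)).trans
      (Nat.divModEquiv 2).symm)).trans (finSumNatEquiv p)
  have hφo : Orthonormal ℂ (v ∘ e.symm) := hv.comp _ e.symm.injective
  have hφc : (Submodule.span ℂ (Set.range (v ∘ e.symm)))ᗮ = ⊥ := by
    rw [e.symm.surjective.range_comp, hvc]
  let φ := HilbertBasis.mkOfOrthogonalEqBot hφo hφc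
  have hφ : ∀ i, φ (e i) = v i := fun i => by
    simp [φ]
  have hTκ : ∀ x : κ, T (b x) = 0 := fun x => (hker _).1 (b x).2
  have he0 : ∀ i : Fin p, φ i = b (eκ.symm (Sum.inl i)) := by
    intro i
    have := hφ (Sum.inr (eκ.symm (Sum.inl i)))
    simpa [e, e1, v] using this
  have he1 : ∀ (s : S) (j : Fin 2), φ (p + 2 * e2 (Sum.inl s) + j) = pairFamily T S (s, j) := by
    intro s j
    have := hφ (Sum.inl (s, j))
    simpa [e, e1, v, mul_comm, add_assoc] using this
  have he2 : ∀ (s : κ') (j : Fin 2), φ (p + 2 * e2 (Sum.inr s) + j)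
      = b (eκ.symm (Sum.inr (s, j))) := by
    intro s j
    have := hφ (Sum.inr (eκ.symm (Sum.inr (s, j))))
    simpa [e, e1, v, mul_comm, add_assoc] using this
  have key : ∀ k, ∃ c : ℝ, T (φ (p + 2 * k)) = (c : ℂ) • φ (p + 2 * k + 1) ∧
      T (φ (p + 2 * k + 1)) = -(c : ℂ) • φ (p + 2 * k) := by
    intro k
    -- A pair from `S` has coefficient `‖T s‖`, a pair of kernel vectors has coefficient `0`.
    obtain ⟨s | s, rfl⟩ := e2.surjective k
    · have h0 := he1 s 0
      have h1 := he1 s 1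
      simp only [Fin.val_zero, Fin.val_one, add_zero, pairFamily, if_true, one_ne_zero,
        if_false] at h0 h1
      have hne : (‖T s‖ : ℂ) ≠ 0 := by simpa using hS.prop.map_ne_zero s s.2
      refine ⟨‖T s‖, ?_, ?_⟩
      · rw [h0, h1, smul_smul, mul_inv_cancel₀ hne, one_smul]
      · rw [h0, h1, map_smulₛₗ, hS.prop.map_map hT s.2, smul_smul]
        congr 1
        simp
        field_simp
    · have h0 := he2 s 0
      have h1 := he2 s 1
      simp only [Fin.val_zero, Fin.val_one, add_zero] at h0 h1
      exact ⟨0, by simp [h0, hTκ], by simp [h1, hTκ]⟩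
  choose c hc using key
  refine ⟨φ, c, ?_, fun k => (hc k).1, fun k => (hc k).2⟩
  intro i hi
  have := he0 ⟨i, hi⟩
  simp only at this
  rw [this, hTκ]

end NaturalBasis

/-! ### Expansion of a two-particle vector in basis pairs. -/

section Expansion

variable {H : Type*} [NormedAddCommGroup H] [InnerProductSpace ℂ H] [CompleteSpace H]

theorem orthonormal_wedge_two {H : Type*} [NormedAddCommGroup H] [InnerProductSpace ℂ H]
    (φ : HilbertBasis ℕ ℂ H) :
    Orthonormal ℂ fun q : {q : ℕ × ℕ // q.1 < q.2} => wedge ![φ q.1.1, φ q.1.2] := by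
  classical
  rw [orthonormal_iff_ite]
  rintro ⟨⟨i, j⟩, hij⟩ ⟨⟨k, l⟩, hkl⟩
  have ho := orthonormal_iff_ite.1 φ.orthonormal
  simp only [inner_wedge_two, ho, Subtype.mk.injEq, Prod.mk.injEq]
  simp only at hij hkl
  split_ifs <;> first | omega | simp

theorem pairMap_ext (φ : HilbertBasis ℕ ℂ H) {Ψ Ψ' : AntisymPower H 2}
    (h : ∀ i, pairMap Ψ (φ i) = pairMap Ψ' (φ i)) : Ψ = Ψ' := by
  refine pairMap_injective (ContinuousLinearMap.ext fun f => ?_)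
  have h1 : Dense (Submodule.span ℂ (Set.range φ) : Set H) := by
    rw [dense_iff_closure_eq, ← Submodule.topologicalClosure_coe, φ.dense_span]; rfl
  refine congrFun (Continuous.ext_on h1 (pairMap Ψ).continuous (pairMap Ψ').continuous ?_) f
  intro x hx
  induction hx using Submodule.span_induction with
  | mem x hx => obtain ⟨i, rfl⟩ := hx; exact h i
  | zero => simp
  | add x y _ _ hx hy => simp only [map_add, hx, hy]
  | smul a x _ hx => simp only [map_smulₛₗ, hx]

theorem orthogonal_span_wedge_two (φ : HilbertBasis ℕ ℂ H) :
    (Submodule.span ℂ (Set.range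
      fun q : {q : ℕ × ℕ // q.1 < q.2} => wedge ![φ q.1.1, φ q.1.2]))ᗮ = ⊥ := by
  rw [eq_bot_iff]
  intro Ψ hΨ
  rw [Submodule.mem_bot]
  have hlt : ∀ i j, i < j → ⟪φ j, pairMap Ψ (φ i)⟫_ℂ = 0 := fun i j hij => by
    rw [inner_pairMap]
    exact hΨ _ (Submodule.subset_span ⟨⟨(i, j), hij⟩, rfl⟩)
  refine pairMap_ext φ fun i => φ.repr.injective (lp.ext (funext fun j => ?_))
  rw [φ.repr_apply_apply, φ.repr_apply_apply, inner_pairMap 0, inner_zero_right]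
  rcases lt_trichotomy i j with h | rfl | h
  · exact hlt i j h
  · exact inner_self_map_eq_zero (fun f g => inner_pairMap_swap Ψ f g) _
  · rw [inner_pairMap_swap, hlt j i h, neg_zero]

/-- The expansion of a two-particle vector in a basis of pairs. -/
theorem hasSum_pairs (φ : HilbertBasis ℕ ℂ H) (Ψ : AntisymPower H 2) (p : ℕ) (c : ℕ → ℝ)
    (h0 : ∀ i < p, pairMap Ψ (φ i) = 0)
    (h1 : ∀ k, pairMap Ψ (φ (p + 2 * k)) = (c k : ℂ) • φ (p + 2 * k + 1))
    (h2 : ∀ k, pairMap Ψ (φ (p + 2 * k + 1)) = -(c k : ℂ) • φ (p + 2 * k)) :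
    HasSum (fun k => (c k : ℂ) • wedge ![φ (p + 2 * k), φ (p + 2 * k + 1)]) Ψ := by
  have ho := orthonormal_iff_ite.1 φ.orthonormal
  let B := HilbertBasis.mkOfOrthogonalEqBot (orthonormal_wedge_two φ) (orthogonal_span_wedge_two φ)
  have hB := B.hasSum_repr Ψ
  let g : ℕ → {q : ℕ × ℕ // q.1 < q.2} := fun k => ⟨(p + 2 * k, p + 2 * k + 1), by simp⟩
  have hg : Function.Injective g := by
    intro k l h
    simp only [g, Subtype.mk.injEq, Prod.mk.injEq] at h
    omega
  have hBg : ∀ q, B q = wedge ![φ q.1.1, φ q.1.2] := fun q => by simp [B]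
  have hrepr : ∀ q, B.repr Ψ q = ⟪φ q.1.2, pairMap Ψ (φ q.1.1)⟫_ℂ := fun q => by
    rw [B.repr_apply_apply, hBg, inner_pairMap]
  -- In the expansion over all `i < j`, only the index pairs in the range of `g` can have a nonzero
  -- coefficient `⟪φ j, T (φ i)⟫`.
  rw [← hg.hasSum_iff] at hB
  · convert hB using 2 with k
    simp [hrepr, hBg, g, h1, φ.orthonormal.1]
  · rintro ⟨⟨i, j⟩, hij⟩ hq
    rw [hrepr]
    simp only at hij ⊢
    have : ⟪φ j, pairMap Ψ (φ i)⟫_ℂ = 0 := by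
      rcases lt_or_ge i p with hi | hi
      · rw [h0 i hi, inner_zero_right]
      · obtain ⟨m, rfl⟩ := Nat.exists_eq_add_of_le hi
        rcases Nat.even_or_odd' m with ⟨k, rfl | rfl⟩
        · rw [h1, inner_smul_right, ho, if_neg, mul_zero]
          rintro rfl
          exact hq ⟨k, rfl⟩
        · rw [← add_assoc, h2, inner_smul_right, ho, if_neg (by omega), mul_zero]
    rw [this, zero_smul]

end Expansion

/-! ### Slater determinants with two occupied sites. -/

section Slater

variable {H : Type*} [NormedAddCommGroup H] [InnerProductSpace ℂ H]

/-- The inclusion of the `N`-particle space into Fock space as a linear isometry. -/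
def sectorInclusion (N : ℕ) : AntisymPower H N →ₗᵢ[ℂ] FockSpace H where
  toFun := inSector N
  map_add' := lp.single_add 2 N
  map_smul' := fun c Ψ => lp.single_smul 2 N c Ψ
  norm_map' := fun Ψ => lp.norm_single (by norm_num) N Ψ

theorem slater_eq_of_card (φ : HilbertBasis ℕ ℂ H) {L N : ℕ} (μ : Fin L → Fin 2)
    (h : (Finset.univ.filter fun i => μ i = 1).card = N) :
    slater φ μ = inSector N (wedge fun k =>
      φ ((Finset.univ.filter fun i => μ i = 1).orderEmbOfFin h k)) := by
  subst h; rfl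

theorem slater_eq_wedge_two (φ : HilbertBasis ℕ ℂ H) {L : ℕ} (μ : Fin L → Fin 2) {i j : Fin L}
    (hij : i < j) (hμ : ∀ x, μ x = 1 ↔ x = i ∨ x = j) :
    slater φ μ = inSector 2 (wedge ![φ i, φ j]) := by
  have hS : (Finset.univ.filter fun x => μ x = 1) = {i, j} := by
    ext x; simp [hμ]
  have hc : (Finset.univ.filter fun x => μ x = 1).card = 2 := by
    rw [hS, Finset.card_pair hij.ne]
  have hf : ![i, j] = (Finset.univ.filter fun x => μ x = 1).orderEmbOfFin hc := by
    refine Finset.orderEmbOfFin_unique hc (fun x => ?_) ?_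
    · rw [hS]; fin_cases x <;> simp
    · intro x y hxy
      fin_cases x <;> fin_cases y <;> simp at hxy ⊢
      exact hij
  rw [slater_eq_of_card φ μ hc, ← hf]
  congr 2
  ext x; fin_cases x <;> rfl

end Slater

/-! ### The tensors generating a sum of pairs. -/

section PairTensors

open Classical in
/-- The complex number `1` or `0` according to whether `P` holds. -/
def indicator (P : Prop) : ℂ := if P then 1 else 0

/-- The transition weights of the matrix product state of the pairs `(p + 2 k, p + 2 k + 1)`.
The state `0` means that all sites so far are empty; after an odd number of sites beyond `p`
the state `1` means that the first site of a pair has been occupied; the last state means that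
a pair is complete. -/
def pairWeight (p : ℕ) (c : ℕ → ℂ) (L : ℕ) (b : Fin 2) (s t : ℕ) : ℂ :=
  if L < p then (if b = 0 ∧ s = 0 ∧ t = 0 then 1 else 0)
  else if Even (L - p) then
    (if b = 0 then (if s = 0 ∧ t = 0 ∨ s = 1 ∧ t = 2 then 1 else 0)
      else if s = 0 ∧ t = 1 then 1 else 0)
  else (if b = 0 then (if s = 0 ∧ t = 0 ∨ s = 2 ∧ t = 1 then 1 else 0)
      else if s = 1 ∧ t = 1 then c ((L - p) / 2) else 0)

/-- The first `L` sites are empty. -/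
def AllEmpty (L : ℕ) (μ : ℕ → Fin 2) : Prop := ∀ i < L, μ i = 0

/-- Among the first `L` sites exactly those of the pair `k` are occupied. -/
def OnlyPair (p L k : ℕ) (μ : ℕ → Fin 2) : Prop :=
  ∀ i < L, μ i = 1 ↔ i = p + 2 * k ∨ i = p + 2 * k + 1

theorem allEmpty_succ (L : ℕ) (μ : ℕ → Fin 2) :
    AllEmpty (L + 1) μ ↔ AllEmpty L μ ∧ μ L = 0 := by
  simp only [AllEmpty, Nat.lt_succ_iff_lt_or_eq, or_imp, forall_and, forall_eq]

theorem onlyPair_succ {p L k : ℕ} (h : p + 2 * k + 1 < L) (μ : ℕ → Fin 2) :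
    OnlyPair p (L + 1) k μ ↔ OnlyPair p L k μ ∧ μ L = 0 := by
  simp only [OnlyPair, Nat.lt_succ_iff_lt_or_eq, or_imp, forall_and, forall_eq]
  have h1 : ¬ (L = p + 2 * k ∨ L = p + 2 * k + 1) := by omega
  have h2 : ¬ μ L = 1 ↔ μ L = 0 := by
    generalize μ L = x; revert x; decide
  simp only [h1, iff_false, h2]

theorem onlyPair_last (p k : ℕ) (μ : ℕ → Fin 2) :
    OnlyPair p (p + 2 * k + 1 + 1) k μ ↔
      (AllEmpty (p + 2 * k) μ ∧ μ (p + 2 * k) = 1) ∧ μ (p + 2 * k + 1) = 1 := by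
  simp only [OnlyPair, AllEmpty, Nat.lt_succ_iff_lt_or_eq, or_imp, forall_and, forall_eq]
  have h2 : ∀ x, ¬ μ x = 1 ↔ μ x = 0 := by
    intro x; generalize μ x = y; revert y; decide
  simp only [true_or, or_true, iff_true]
  refine and_congr_left fun _ => and_congr_left fun _ => forall₂_congr fun i hi => ?_
  rw [← h2]
  have : ¬ (i = p + 2 * k ∨ i = p + 2 * k + 1) := by omega
  simp [this]

/-- The row vector of the tensors after `p + 2 m` sites. -/
def evenRow (p : ℕ) (c : ℕ → ℂ) (m : ℕ) (μ : ℕ → Fin 2) (s : ℕ) : ℂ :=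
  if s = 0 then indicator (AllEmpty (p + 2 * m) μ)
  else if s = 1 then ∑ k ∈ Finset.range m, c k * indicator (OnlyPair p (p + 2 * m) k μ)
  else 0

/-- The row vector of the tensors after `p + 2 m + 1` sites. -/
def oddRow (p : ℕ) (c : ℕ → ℂ) (m : ℕ) (μ : ℕ → Fin 2) (s : ℕ) : ℂ :=
  if s = 0 then indicator (AllEmpty (p + 2 * m + 1) μ)
  else if s = 1 then indicator (AllEmpty (p + 2 * m) μ ∧ μ (p + 2 * m) = 1)
  else if s = 2 then ∑ k ∈ Finset.range m, c k * indicator (OnlyPair p (p + 2 * m + 1) k μ)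
  else 0

theorem fin_two_cases (x : Fin 2) : x = 0 ∨ x = 1 := by revert x; decide

theorem sum_evenRow (p : ℕ) (c : ℕ → ℂ) (m : ℕ) (μ : ℕ → Fin 2) (t : ℕ) :
    ∑ s ∈ Finset.range 3, evenRow p c m μ s * pairWeight p c (p + 2 * m) (μ (p + 2 * m)) s t
      = oddRow p c m μ t := by
  have h : ∀ k ∈ Finset.range m, c k * indicator (OnlyPair p (p + 2 * m + 1) k μ)
      = c k * indicator (OnlyPair p (p + 2 * m) k μ ∧ μ (p + 2 * m) = 0) := fun k hk => by
    rw [onlyPair_succ]; have := Finset.mem_range.1 hk; omega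
  rw [oddRow, Finset.sum_congr rfl h, allEmpty_succ]
  rcases fin_two_cases (μ (p + 2 * m)) with hb | hb <;>
  rcases t with _ | _ | _ | t <;>
  simp only [hb, and_true, and_false, zero_ne_one, one_ne_zero, Finset.sum_range_succ] <;>
  simp [evenRow, pairWeight, indicator]

theorem sum_oddRow (p : ℕ) (c : ℕ → ℂ) (m : ℕ) (μ : ℕ → Fin 2) (t : ℕ) :
    ∑ s ∈ Finset.range 3, oddRow p c m μ s *
        pairWeight p c (p + 2 * m + 1) (μ (p + 2 * m + 1)) s t
      = evenRow p c (m + 1) μ t := by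
  have h : ∀ k ∈ Finset.range m, c k * indicator (OnlyPair p (p + 2 * m + 1 + 1) k μ)
      = c k * indicator (OnlyPair p (p + 2 * m + 1) k μ ∧ μ (p + 2 * m + 1) = 0) := fun k hk => by
    rw [onlyPair_succ]; have := Finset.mem_range.1 hk; omega
  have h1 : p + 2 * (m + 1) = p + 2 * m + 1 + 1 := by ring
  have h2 : ¬ (p + 2 * m + 1 < p) := by omega
  have h3 : p + 2 * m + 1 - p = 2 * m + 1 := by omega
  have h4 : (2 * m + 1) / 2 = m := by omega
  have h5 : ¬ Even (2 * m + 1) := by simp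
  -- The summand `k = m` is the pair completed at this very site; it comes from the half-pair state
  -- and picks up the weight `c m`.
  rw [evenRow, h1, Finset.sum_range_succ (n := m), Finset.sum_congr rfl h, allEmpty_succ (p + 2 * m + 1),
    onlyPair_last]
  simp only [pairWeight, h2, h3, h4, h5, if_false]
  rcases fin_two_cases (μ (p + 2 * m + 1)) with hb | hb <;>
  rcases t with _ | _ | _ | t <;>
  simp only [hb, and_true, and_false, zero_ne_one, one_ne_zero, Finset.sum_range_succ] <;>
  simp [oddRow, indicator]

variable {r : ℕ → ℕ}
  (A : ∀ i : ℕ, Fin 2 → Matrix (Fin (bond r i)) (Fin (bond r (i + 1))) ℂ)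

/-- Replaces the index type `Fin (bond r L)`, which depends on the site, by the fixed range of three
states; the states in excess contribute zero. -/
theorem tensorProd_succ_eq_sum {w : ℕ → Fin 2 → ℕ → ℕ → ℂ}
    (hA : ∀ i b s t, A i b s t = w i b s t) {L : ℕ} (hL : bond r L ≤ 3) {μ : ℕ → Fin 2}
    {F : ℕ → ℂ} (hF : ∀ s, tensorProd A L (fun i => μ i) 0 s = F s)
    (hF0 : ∀ s, bond r L ≤ s → F s = 0) (t : Fin (bond r (L + 1))) :
    tensorProd A (L + 1) (fun i => μ i) 0 t
      = ∑ s ∈ Finset.range 3, F s * w L (μ L) s t := by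
  have h1 : ∑ s ∈ Finset.range 3, F s * w L (μ L) s t
      = ∑ s ∈ Finset.range (bond r L), F s * w L (μ L) s t := by
    symm
    refine Finset.sum_subset (Finset.range_subset_range.2 hL) fun s _ hs => ?_
    rw [hF0 s (by simpa using hs), zero_mul]
  rw [h1, Finset.sum_range]
  simp only [tensorProd, Matrix.mul_apply]
  refine Finset.sum_congr rfl fun s _ => ?_
  rw [← hF, ← hA]
  rfl

variable {A} {p : ℕ} {c : ℕ → ℂ}

theorem tensorProd_initial (hA : ∀ i b s t, A i b s t = pairWeight p c i b s t)
    (hb0 : ∀ i ≤ p, bond r i = 1) (μ : ℕ → Fin 2) {L : ℕ} (hL : L ≤ p)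
    (s : Fin (bond r L)) :
    tensorProd A L (fun i => μ i) 0 s = if (s : ℕ) = 0 then indicator (AllEmpty L μ) else 0 := by
  induction L with
  | zero =>
    have hs : s = (0 : Fin 1) := Subsingleton.elim (α := Fin 1) _ _
    subst hs
    simp [tensorProd, indicator, AllEmpty]
  | succ L ih =>
    rw [tensorProd_succ_eq_sum A hA (F := fun s => if s = 0 then indicator (AllEmpty L μ) else 0)
      (by rw [hb0 L (by omega)]; norm_num) (fun s => ih (by omega) s)
      (fun s hs => by rw [hb0 L (by omega)] at hs; rw [if_neg (by omega)])]
    have hs : (s : ℕ) = 0 := by have := s.2; have := hb0 _ hL; omega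
    rw [allEmpty_succ]
    rcases fin_two_cases (μ L) with hb | hb <;>
    simp only [hb, hs, and_true, and_false, one_ne_zero, Finset.sum_range_succ] <;>
    simp [pairWeight, indicator, show L < p by omega]

theorem evenRow_zero (p : ℕ) (c : ℕ → ℂ) (μ : ℕ → Fin 2) (s : ℕ) :
    evenRow p c 0 μ s = if s = 0 then indicator (AllEmpty p μ) else 0 := by
  simp [evenRow]

theorem tensorProd_even_odd (hA : ∀ i b s t, A i b s t = pairWeight p c i b s t)
    (hb0 : ∀ i ≤ p, bond r i = 1) (hb1 : bond r (p + 1) = 2)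
    (hbe : ∀ m, bond r (p + 2 * (m + 1)) = 2) (hbo : ∀ m, bond r (p + 2 * (m + 1) + 1) = 3)
    (μ : ℕ → Fin 2) (m : ℕ) :
    (∀ s, tensorProd A (p + 2 * m) (fun i => μ i) 0 s = evenRow p c m μ s) ∧
    (∀ s, tensorProd A (p + 2 * m + 1) (fun i => μ i) 0 s = oddRow p c m μ s) := by
  have heo : ∀ m, (∀ s, tensorProd A (p + 2 * m) (fun i => μ i) 0 s = evenRow p c m μ s) →
      ∀ s, tensorProd A (p + 2 * m + 1) (fun i => μ i) 0 s = oddRow p c m μ s := by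
    intro m h s
    -- Before the first pair ends there is no "complete" state: its sum over `k < 0` is empty, so a
    -- bond smaller by one suffices.
    have hbm : m = 0 ∧ bond r (p + 2 * m) = 1 ∨ bond r (p + 2 * m) = 2 := by
      rcases m with _ | m
      · exact Or.inl ⟨rfl, hb0 p le_rfl⟩
      · exact Or.inr (hbe m)
    rw [tensorProd_succ_eq_sum A hA (by omega) h, sum_evenRow]
    intro s hs
    rcases hbm with ⟨rfl, hb⟩ | hb
    · rw [evenRow_zero, if_neg (by omega)]
    · rw [evenRow, if_neg (by omega), if_neg (by omega)]
  have hoe : ∀ m, (∀ s, tensorProd A (p + 2 * m + 1) (fun i => μ i) 0 s = oddRow p c m μ s) →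
      ∀ s, tensorProd A (p + 2 * m + 1 + 1) (fun i => μ i) 0 s = evenRow p c (m + 1) μ s := by
    intro m h s
    have hbm : m = 0 ∧ bond r (p + 2 * m + 1) = 2 ∨ bond r (p + 2 * m + 1) = 3 := by
      rcases m with _ | m
      · exact Or.inl ⟨rfl, hb1⟩
      · exact Or.inr (hbo m)
    rw [tensorProd_succ_eq_sum A hA (by omega) h, sum_oddRow]
    intro s hs
    rcases hbm with ⟨rfl, hb⟩ | hb
    · rw [oddRow, if_neg (by omega), if_neg (by omega)]
      simp
    · rw [oddRow, if_neg (by omega), if_neg (by omega), if_neg (by omega)]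
  have he : ∀ s, tensorProd A (p + 2 * m) (fun i => μ i) 0 s = evenRow p c m μ s := by
    induction m with
    | zero =>
      intro s
      rw [evenRow_zero]
      exact tensorProd_initial hA hb0 μ le_rfl s
    | succ m ih => exact hoe m (heo m ih)
  exact ⟨he, heo m he⟩

theorem mulVec_lastVec {L : ℕ} {n : ℕ} (hn : bond r L = n + 1)
    (M : Matrix (Fin 1) (Fin (bond r L)) ℂ) {F : ℕ → ℂ} (hM : ∀ s, M 0 s = F s) :
    M.mulVec (lastVec (bond r L)) 0 = F n := by
  have h := Finset.sum_range (n := bond r L) (fun s => F s * if s + 1 = bond r L then 1 else 0)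
  simp only [Matrix.mulVec, dotProduct, lastVec, hM]
  rw [← h, hn]
  simp

/-- The extension of finitely many occupation numbers by zero. -/
def extendZero {L : ℕ} (μ : Fin L → Fin 2) (i : ℕ) : Fin 2 := if h : i < L then μ ⟨i, h⟩ else 0

theorem extendZero_val {L : ℕ} (μ : Fin L → Fin 2) : (fun i : Fin L => extendZero μ i) = μ := by
  ext i; simp [extendZero]

variable {H : Type*} [NormedAddCommGroup H] [InnerProductSpace ℂ H]

theorem sum_indicator_onlyPair_smul_slater (φ : HilbertBasis ℕ ℂ H) {L k : ℕ}
    (h : p + 2 * k + 1 < L) :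
    ∑ μ : Fin L → Fin 2, indicator (OnlyPair p L k (extendZero μ)) • slater φ μ
      = inSector 2 (wedge ![φ (p + 2 * k), φ (p + 2 * k + 1)]) := by
  let i : Fin L := ⟨p + 2 * k, by omega⟩
  let j : Fin L := ⟨p + 2 * k + 1, h⟩
  let ν : Fin L → Fin 2 := fun x => if x = i ∨ x = j then 1 else 0
  have hν : ∀ x, ν x = 1 ↔ x = i ∨ x = j := fun x => by simp only [ν]; split_ifs with h <;> simp [h]
  have key : ∀ μ : Fin L → Fin 2, OnlyPair p L k (extendZero μ) ↔ μ = ν := by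
    intro μ
    have h1 : OnlyPair p L k (extendZero μ) ↔ ∀ x : Fin L, μ x = 1 ↔ x = i ∨ x = j := by
      constructor
      · intro hμ x
        have := hμ x x.2
        simpa [extendZero, Fin.ext_iff, i, j] using this
      · intro hμ x hx
        have := hμ ⟨x, hx⟩
        simpa [extendZero, hx, i, j] using this
    rw [h1]
    constructor
    · intro hμ
      funext x
      by_cases hx : x = i ∨ x = j
      · rw [(hμ x).2 hx, (hν x).2 hx]
      · rcases fin_two_cases (μ x) with h0 | h0
        · rw [h0]; simp [ν, hx]
        · exact absurd ((hμ x).1 h0) hx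
    · rintro rfl; exact hν
  rw [Finset.sum_eq_single ν]
  · rw [indicator, if_pos ((key ν).2 rfl), one_smul]
    have hij : i < j := Nat.lt_succ_self _
    rw [slater_eq_wedge_two φ ν hij hν]
  · intro μ _ hμ
    rw [indicator, if_neg (fun h => hμ ((key μ).1 h)), zero_smul]
  · simp

/-- The closing column selects the last state, which is why "complete" is numbered `1` or `2`
according to the bond dimension. For `L < p + 2` the last state has another meaning, hence the bound
on `L`. -/
theorem finiteMPS_eq_sum_pairs (hA : ∀ i b s t, A i b s t = pairWeight p c i b s t)
    (hb0 : ∀ i ≤ p, bond r i = 1) (hb1 : bond r (p + 1) = 2)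
    (hbe : ∀ m, bond r (p + 2 * (m + 1)) = 2) (hbo : ∀ m, bond r (p + 2 * (m + 1) + 1) = 3)
    (φ : HilbertBasis ℕ ℂ H) {L : ℕ} (hL : p + 2 ≤ L) :
    finiteMPS φ A L = inSector 2
      (∑ k ∈ Finset.range ((L - p) / 2), c k • wedge ![φ (p + 2 * k), φ (p + 2 * k + 1)]) := by
  have hcoef : ∀ μ : Fin L → Fin 2, (tensorProd A L μ).mulVec (lastVec (bond r L)) 0
      = ∑ k ∈ Finset.range ((L - p) / 2), c k * indicator (OnlyPair p L k (extendZero μ)) := by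
    intro μ
    have hT := tensorProd_even_odd hA hb0 hb1 hbe hbo (extendZero μ)
    obtain ⟨m, hm⟩ : ∃ m, L = p + 2 * (m + 1) ∨ L = p + 2 * (m + 1) + 1 :=
      ⟨(L - p) / 2 - 1, by omega⟩
    have hm2 : (L - p) / 2 = m + 1 := by omega
    rw [hm2]
    rcases hm with rfl | rfl
    · have h := (hT (m + 1)).1
      rw [extendZero_val] at h
      rw [mulVec_lastVec (hbe m) _ h]
      simp [evenRow]
    · have h := (hT (m + 1)).2
      rw [extendZero_val] at h
      rw [mulVec_lastVec (hbo m) _ h]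
      simp [oddRow]
  change _ = sectorInclusion 2 _
  rw [finiteMPS, map_sum]
  simp_rw [hcoef, Finset.sum_smul]
  rw [Finset.sum_comm]
  refine Finset.sum_congr rfl fun k hk => ?_
  have hk' := Finset.mem_range.1 hk
  simp_rw [mul_smul]
  rw [← Finset.smul_sum, sum_indicator_onlyPair_smul_slater φ (by omega), map_smul]
  rfl

/-- A convergent sum of pairs is a half-infinite matrix product state. -/
theorem inSector_mem_halfInfiniteMPS (hb0 : ∀ i ≤ p, bond r i = 1) (hb1 : bond r (p + 1) = 2)
    (hbe : ∀ m, bond r (p + 2 * (m + 1)) = 2) (hbo : ∀ m, bond r (p + 2 * (m + 1) + 1) = 3)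
    (φ : HilbertBasis ℕ ℂ H) {Ψ : AntisymPower H 2}
    (hΨ : HasSum (fun k => c k • wedge ![φ (p + 2 * k), φ (p + 2 * k + 1)]) Ψ) :
    inSector 2 Ψ ∈ halfInfiniteMPS r φ := by
  refine ⟨fun i b => Matrix.of fun s t => pairWeight p c i b s t, ?_⟩
  have h1 : Tendsto (fun L => (L - p) / 2) atTop atTop :=
    (Nat.tendsto_div_const_atTop two_ne_zero).comp (tendsto_sub_atTop_nat p)
  have h2 := ((sectorInclusion (H := H) 2).continuous.tendsto Ψ).comp
    (hΨ.tendsto_sum_nat.comp h1)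
  refine h2.congr' ?_
  filter_upwards [eventually_ge_atTop (p + 2)] with L hL
  exact (finiteMPS_eq_sum_pairs (fun i b s t => rfl) hb0 hb1 hbe hbo φ hL).symm

end PairTensors

/-! ### Orthonormality of Slater determinants. -/

section SlaterOrthonormal

variable {H : Type*} [NormedAddCommGroup H] [InnerProductSpace ℂ H]

/-- The Slater determinant of a finite set of orbitals. -/
def slaterSet (φ : HilbertBasis ℕ ℂ H) (S : Finset ℕ) : FockSpace H :=
  inSector S.card (wedge fun k => φ (S.orderEmbOfFin rfl k))

/-- The occupation numbers of a set of sites. -/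
def occupation (S : Finset ℕ) (i : ℕ) : Fin 2 := if i ∈ S then 1 else 0

theorem occupation_eq_one_iff (S : Finset ℕ) (i : ℕ) : occupation S i = 1 ↔ i ∈ S := by
  simp [occupation]

theorem slater_occupation (φ : HilbertBasis ℕ ℂ H) {S : Finset ℕ} {L : ℕ} (hS : ∀ x ∈ S, x < L) :
    slater φ (fun i : Fin L => occupation S i) = slaterSet φ S := by
  set F : Finset (Fin L) := Finset.univ.filter fun i : Fin L => occupation S i = 1 with hF
  have hmem : ∀ x : Fin L, x ∈ F ↔ (x : ℕ) ∈ S := fun x => by simp [hF, occupation]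
  have himg : F.map Fin.valEmbedding = S := by
    ext x
    simp only [Finset.mem_map, hmem, Fin.valEmbedding_apply]
    constructor
    · rintro ⟨y, hy, rfl⟩; exact hy
    · intro hx; exact ⟨⟨x, hS x hx⟩, hx, rfl⟩
  have hc : F.card = S.card := by rw [← himg, Finset.card_map]
  have hf : (fun k => ((F.orderEmbOfFin hc k : Fin L) : ℕ)) = S.orderEmbOfFin rfl := by
    refine Finset.orderEmbOfFin_unique rfl (fun x => ?_) ?_
    · exact (hmem _).1 (F.orderEmbOfFin_mem hc x)
    · intro x y hxy
      exact (F.orderEmbOfFin hc).strictMono hxy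
  rw [slater_eq_of_card φ _ hc, slaterSet]
  congr 2
  funext k
  rw [← hf]

theorem slaterSet_pair (φ : HilbertBasis ℕ ℂ H) {i j : ℕ} (hij : i < j) :
    slaterSet φ {i, j} = inSector 2 (wedge ![φ i, φ j]) := by
  rw [← slater_occupation φ (L := j + 1) (by intro x hx; simp at hx; omega)]
  exact slater_eq_wedge_two φ _ (i := ⟨i, by omega⟩) (j := ⟨j, by omega⟩) hij
    (fun x => by rw [occupation_eq_one_iff]; simp [Fin.ext_iff])

theorem inner_inSector_of_ne {N M : ℕ} (h : N ≠ M) (x : AntisymPower H N) (y : AntisymPower H M) :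
    ⟪inSector N x, inSector M y⟫_ℂ = 0 := by
  rw [inSector, inSector, lp.inner_single_left, lp.single_apply_ne _ _ _ h, inner_zero_right]

theorem inner_slater (φ : HilbertBasis ℕ ℂ H) {L : ℕ} (μ ν : Fin L → Fin 2) :
    ⟪slater φ μ, slater φ ν⟫_ℂ = if μ = ν then 1 else 0 := by
  set S : Finset (Fin L) := Finset.univ.filter fun i => μ i = 1 with hS
  set T : Finset (Fin L) := Finset.univ.filter fun i => ν i = 1 with hT
  have ho := orthonormal_iff_ite.1 φ.orthonormal
  by_cases hc : S.card = T.card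
  · rw [slater_eq_of_card φ μ hc, slater_eq_of_card φ ν rfl]
    change ⟪sectorInclusion _ _, sectorInclusion _ _⟫_ℂ = _
    rw [LinearIsometry.inner_map_map, inner_wedge]
    split_ifs with h
    · subst h
      convert Matrix.det_one (n := Fin T.card) (R := ℂ)
      ext i j
      simp [ho, Fin.val_inj, Matrix.one_apply]
    -- Distinct sets of equal size: an orbital in `S` but not in `T` produces a zero row of the Gram
    -- matrix.
    · have hne : ¬ S ⊆ T := fun hsub => by
        have hST := Finset.eq_of_subset_of_card_le hsub hc.ge
        refine h (funext fun x => ?_)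
        have hx : μ x = 1 ↔ ν x = 1 := by
          simpa [hS, hT] using Finset.ext_iff.1 hST x
        rcases fin_two_cases (μ x) with h0 | h0 <;> rcases fin_two_cases (ν x) with h1 | h1 <;>
          simp_all
      obtain ⟨x, hxS, hxT⟩ := Finset.not_subset.1 hne
      have hx : x ∈ Set.range (S.orderEmbOfFin hc) := by
        rw [Finset.range_orderEmbOfFin]; exact hxS
      obtain ⟨k, hk⟩ := hx
      refine Matrix.det_eq_zero_of_row_eq_zero k fun j => ?_
      simp only [Matrix.of_apply]
      rw [hk, ho, if_neg]
      intro hxj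
      refine hxT ?_
      rw [Fin.ext hxj]
      exact T.orderEmbOfFin_mem rfl j
  · rw [if_neg (fun h => hc (by rw [hS, hT, h])), slater, slater]
    exact inner_inSector_of_ne hc _ _

end SlaterOrthonormal

/-! ### Vanishing minors across a cut. -/

section Minors

variable {r : ℕ → ℕ}
  (A : ∀ i : ℕ, Fin 2 → Matrix (Fin (bond r i)) (Fin (bond r (i + 1))) ℂ)

theorem exists_tensorProd_eq_mul {l L : ℕ} (h : l ≤ L) :
    ∃ Y : (ℕ → Fin 2) → Matrix (Fin (bond r l)) (Fin (bond r L)) ℂ,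
      (∀ μ ν, (∀ i, l ≤ i → μ i = ν i) → Y μ = Y ν) ∧
      ∀ μ : ℕ → Fin 2, tensorProd A L (fun i => μ i) = tensorProd A l (fun i => μ i) * Y μ := by
  induction L, h using Nat.le_induction with
  | base => exact ⟨fun _ => 1, fun _ _ _ => rfl, fun μ => (Matrix.mul_one _).symm⟩
  | succ L hL ih =>
    obtain ⟨Y, hY, hYm⟩ := ih
    refine ⟨fun μ => Y μ * A L (μ L), fun μ ν h => ?_, fun μ => ?_⟩
    · simp only [hY μ ν h, h L hL]
    · rw [← Matrix.mul_assoc, ← hYm]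
      rfl

/-- The coefficient of the Slater determinant with occupation numbers `μ` in the finite matrix
product state on `L` sites. -/
def mpsCoeff (L : ℕ) (μ : ℕ → Fin 2) : ℂ :=
  (tensorProd A L (fun i => μ i)).mulVec (lastVec (bond r L)) 0

/-- Cutting the tensor product at `l` factors the matrix through a space of dimension `bond r l ≤
2`. -/
theorem det_mpsCoeff_eq_zero (hr : ∀ i, r i ≤ 2) {l L : ℕ} (h : l ≤ L) (S T : Fin 3 → Finset ℕ)
    (hS : ∀ a, ∀ x ∈ S a, x < l) (hT : ∀ b, ∀ x ∈ T b, l ≤ x) :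
    Matrix.det (Matrix.of fun a b => mpsCoeff A L (occupation (S a ∪ T b))) = 0 := by
  obtain ⟨Y, hY, hYm⟩ := exists_tensorProd_eq_mul A h
  let P : Matrix (Fin 3) (Fin (bond r l)) ℂ := Matrix.of fun a =>
    tensorProd A l (fun i => occupation (S a) i) 0
  let Q : Matrix (Fin (bond r l)) (Fin 3) ℂ := Matrix.of fun s b =>
    (Y (occupation (T b))).mulVec (lastVec (bond r L)) s
  have hPQ : (Matrix.of fun a b => mpsCoeff A L (occupation (S a ∪ T b))) = P * Q := by
    ext a b
    have h1 : Y (occupation (S a ∪ T b)) = Y (occupation (T b)) := by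
      refine hY _ _ fun i hi => ?_
      have : i ∉ S a := fun hx => absurd (hS a i hx) (by omega)
      simp [occupation, this]
    have h2 : (fun i : Fin l => occupation (S a ∪ T b) i) = fun i : Fin l => occupation (S a) i := by
      funext i
      have : (i : ℕ) ∉ T b := fun hx => absurd (hT b i hx) (by omega)
      simp [occupation, this]
    rw [Matrix.of_apply, mpsCoeff, hYm, h1, h2, ← Matrix.mulVec_mulVec]
    rfl
  have hb : bond r l ≤ 2 := by
    rcases l with _ | l
    · exact one_le_two
    · exact hr _
  rw [hPQ]
  by_contra hdet
  have hrank := Matrix.rank_of_isUnit (P * Q)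
    ((Matrix.isUnit_iff_isUnit_det _).2 (isUnit_iff_ne_zero.2 hdet))
  have h3 := (Matrix.rank_mul_le_left P Q).trans (Matrix.rank_le_card_width P)
  rw [hrank] at h3
  simp only [Fintype.card_fin] at h3
  omega

variable {H : Type*} [NormedAddCommGroup H] [InnerProductSpace ℂ H]

theorem inner_slaterSet_finiteMPS (φ : HilbertBasis ℕ ℂ H) {S : Finset ℕ} {L : ℕ}
    (hS : ∀ x ∈ S, x < L) :
    ⟪slaterSet φ S, finiteMPS φ A L⟫_ℂ = mpsCoeff A L (occupation S) := by
  rw [finiteMPS, inner_sum, ← slater_occupation φ hS]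
  simp_rw [inner_smul_right, inner_slater]
  simp [mpsCoeff]

variable {A}

theorem tendsto_mpsCoeff {φ : HilbertBasis ℕ ℂ H} {Φ : FockSpace H}
    (h : Tendsto (fun L => finiteMPS φ A L) atTop (𝓝 Φ)) (S : Finset ℕ) :
    Tendsto (fun L => mpsCoeff A L (occupation S)) atTop (𝓝 ⟪slaterSet φ S, Φ⟫_ℂ) := by
  refine ((tendsto_const_nhds (x := slaterSet φ S)).inner h).congr' ?_
  filter_upwards [eventually_gt_atTop (S.sup id)] with L hL
  exact inner_slaterSet_finiteMPS A φ fun x hx => (Finset.le_sup (f := id) hx).trans_lt hL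

/-- The minors of order three of the coefficient matrix of a matrix product state with bond
dimensions at most two vanish across every cut. -/
theorem det_inner_slaterSet_eq_zero (hr : ∀ i, r i ≤ 2) {φ : HilbertBasis ℕ ℂ H}
    {Φ : FockSpace H} (hΦ : Φ ∈ halfInfiniteMPS r φ) (l : ℕ) (S T : Fin 3 → Finset ℕ)
    (hS : ∀ a, ∀ x ∈ S a, x < l) (hT : ∀ b, ∀ x ∈ T b, l ≤ x) :
    Matrix.det (Matrix.of fun a b => ⟪slaterSet φ (S a ∪ T b), Φ⟫_ℂ) = 0 := by
  obtain ⟨A, hA⟩ := hΦ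
  have h1 : Tendsto (fun L => Matrix.of fun a b => mpsCoeff A L (occupation (S a ∪ T b))) atTop
      (𝓝 (Matrix.of fun a b => ⟪slaterSet φ (S a ∪ T b), Φ⟫_ℂ)) := by
    exact tendsto_pi_nhds.2 fun a => tendsto_pi_nhds.2 fun b => tendsto_mpsCoeff hA _
  have h2 := ((continuous_id.matrix_det).tendsto _).comp h1
  refine tendsto_nhds_unique h2 (tendsto_const_nhds.congr' ?_)
  filter_upwards [eventually_ge_atTop l] with L hL
  exact (det_mpsCoeff_eq_zero A hr hL S T hS hT).symm

end Minors

/-! ### The minors of a two-particle state. -/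

section PairMinors

variable {H : Type*} [NormedAddCommGroup H] [InnerProductSpace ℂ H] [CompleteSpace H]
  {r : ℕ → ℕ} {φ : HilbertBasis ℕ ℂ H} {Ψ : AntisymPower H 2}

theorem inner_slaterSet_inSector_two_pair (φ : HilbertBasis ℕ ℂ H) (Ψ : AntisymPower H 2)
    {i j : ℕ} (hij : i < j) :
    ⟪slaterSet φ {i, j}, inSector 2 Ψ⟫_ℂ = ⟪φ j, pairMap Ψ (φ i)⟫_ℂ := by
  rw [slaterSet_pair φ hij, inner_pairMap]
  exact (sectorInclusion 2).inner_map_map _ _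

theorem mul_mul_eq_zero_of_mem_halfInfiniteMPS (hr : ∀ i, r i ≤ 2)
    (hΨ : inSector 2 Ψ ∈ halfInfiniteMPS r φ) {l a₁ a₂ a b b₁ b₂ : ℕ} (ha₁ : a₁ < a₂)
    (ha₂ : a₂ < l) (ha : a < l) (hb : l ≤ b) (hb₁ : l ≤ b₁) (hb₂ : b₁ < b₂) :
    ⟪φ a₂, pairMap Ψ (φ a₁)⟫_ℂ * ⟪φ b, pairMap Ψ (φ a)⟫_ℂ * ⟪φ b₂, pairMap Ψ (φ b₁)⟫_ℂ = 0 := by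
  -- With this order, the entries above the diagonal have fewer than two particles, so the
  -- determinant is the product of the diagonal.
  have h := det_inner_slaterSet_eq_zero hr hΨ l ![∅, {a}, {a₁, a₂}] ![{b₁, b₂}, {b}, ∅]
    (by intro i; fin_cases i <;> simp <;> omega) (by intro i; fin_cases i <;> simp <;> omega)
  have hz : ∀ S : Finset ℕ, S.card ≠ 2 → ⟪slaterSet φ S, inSector 2 Ψ⟫_ℂ = 0 := fun S hS =>
    inner_inSector_of_ne hS _ _
  have hp : ∀ i j, i < j → ⟪slaterSet φ {i, j}, inSector 2 Ψ⟫_ℂ = ⟪φ j, pairMap Ψ (φ i)⟫_ℂ :=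
    fun i j hij => inner_slaterSet_inSector_two_pair φ Ψ hij
  have e1 : ({a} ∪ {b} : Finset ℕ) = {a, b} := rfl
  have z4 := hz {a} (by simp)
  have z5 := hz {b} (by simp)
  have z6 := hz ∅ (by simp)
  rw [Matrix.det_fin_three] at h
  simp [z4, z5, z6, e1, hp a b (by omega), hp _ _ ha₁, hp _ _ hb₂] at h
  simp only [mul_eq_zero]
  tauto

theorem mul_minor_eq_zero_of_mem_halfInfiniteMPS (hr : ∀ i, r i ≤ 2)
    (hΨ : inSector 2 Ψ ∈ halfInfiniteMPS r φ) {l a₁ a₂ a a' b b' : ℕ} (ha₁ : a₁ < a₂)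
    (ha₂ : a₂ < l) (ha : a < l) (ha' : a' < l) (hb : l ≤ b) (hb' : l ≤ b') :
    ⟪φ a₂, pairMap Ψ (φ a₁)⟫_ℂ * (⟪φ b, pairMap Ψ (φ a)⟫_ℂ * ⟪φ b', pairMap Ψ (φ a')⟫_ℂ -
      ⟪φ b', pairMap Ψ (φ a)⟫_ℂ * ⟪φ b, pairMap Ψ (φ a')⟫_ℂ) = 0 := by
  -- The first column is zero below its top entry, so the determinant is that entry times the lower
  -- right minor.
  have h := det_inner_slaterSet_eq_zero hr hΨ l ![{a₁, a₂}, {a}, {a'}] ![∅, {b}, {b'}]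
    (by intro i; fin_cases i <;> simp <;> omega) (by intro i; fin_cases i <;> simp <;> omega)
  have hz : ∀ S : Finset ℕ, S.card ≠ 2 → ⟪slaterSet φ S, inSector 2 Ψ⟫_ℂ = 0 := fun S hS =>
    inner_inSector_of_ne hS _ _
  have hp : ∀ i j, i < j →
      ⟪slaterSet φ {i, j}, inSector 2 Ψ⟫_ℂ = ⟪φ j, pairMap Ψ (φ i)⟫_ℂ :=
    fun i j hij => inner_slaterSet_inSector_two_pair φ Ψ hij
  have z1 := hz {a} (by simp)
  have z2 := hz {a'} (by simp)
  rw [Matrix.det_fin_three] at h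
  simp [z1, z2, hp _ _ ha₁,
    hp a b (by omega), hp a b' (by omega), hp a' b (by omega), hp a' b' (by omega)] at h
  linear_combination h

end PairMinors

/-! ### Four dimensions contain the range of the operator. -/

section RangeBound

variable {H : Type*} [NormedAddCommGroup H] [InnerProductSpace ℂ H]

theorem hilbertBasis_ext_inner (φ : HilbertBasis ℕ ℂ H) {x y : H}
    (h : ∀ j, ⟪φ j, x⟫_ℂ = ⟪φ j, y⟫_ℂ) : x = y := by
  refine φ.repr.injective (lp.ext (funext fun j => ?_))
  rw [φ.repr_apply_apply, φ.repr_apply_apply, h]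

variable [CompleteSpace H]

theorem pairMap_mem_of_forall_basis {φ : HilbertBasis ℕ ℂ H} {Ψ : AntisymPower H 2}
    {V : Submodule ℂ H} [FiniteDimensional ℂ V] (h : ∀ i, pairMap Ψ (φ i) ∈ V) (f : H) :
    pairMap Ψ f ∈ V := by
  have h1 : Dense (Submodule.span ℂ (Set.range φ) : Set H) := by
    rw [dense_iff_closure_eq, ← Submodule.topologicalClosure_coe, φ.dense_span]; rfl
  have hcl : IsClosed (pairMap Ψ ⁻¹' (V : Set H)) :=
    V.closed_of_finiteDimensional.preimage (pairMap Ψ).continuous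
  have h2 : (Submodule.span ℂ (Set.range φ) : Set H) ⊆ pairMap Ψ ⁻¹' (V : Set H) := by
    intro x hx
    induction hx using Submodule.span_induction with
    | mem x hx => obtain ⟨i, rfl⟩ := hx; exact h i
    | zero => simp
    | add x y _ _ hx hy =>
      simp only [Set.mem_preimage, map_add, SetLike.mem_coe] at hx hy ⊢
      exact V.add_mem hx hy
    | smul a x _ hx =>
      simp only [Set.mem_preimage, map_smulₛₗ, SetLike.mem_coe] at hx ⊢
      exact V.smul_mem _ hx
  exact closure_minimal h2 hcl (h1.closure_eq ▸ Set.mem_univ f)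

/-- If a two-particle vector is a matrix product state with bond dimensions at most two, then the
range of its antilinear operator is spanned by four vectors. -/
theorem exists_span_four_of_mem_halfInfiniteMPS {r : ℕ → ℕ} (hr : ∀ i, r i ≤ 2)
    {φ : HilbertBasis ℕ ℂ H} {Ψ : AntisymPower H 2}
    (hΨ : inSector 2 Ψ ∈ halfInfiniteMPS r φ) :
    ∃ v : Fin 4 → H, ∀ f, pairMap Ψ f ∈ Submodule.span ℂ (Set.range v) := by
  suffices h : ∃ v : Fin 4 → H, ∀ i, pairMap Ψ (φ i) ∈ Submodule.span ℂ (Set.range v) by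
    obtain ⟨v, hv⟩ := h
    have := FiniteDimensional.span_of_finite ℂ (Set.finite_range v)
    exact ⟨v, pairMap_mem_of_forall_basis hv⟩
  classical
  set C : ℕ → ℕ → ℂ := fun i j => ⟪φ j, pairMap Ψ (φ i)⟫_ℂ with hC
  have hanti : ∀ i j, C i j = -C j i := fun i j => inner_pairMap_swap Ψ _ _
  have hdiag : ∀ i, C i i = 0 := fun i => inner_self_map_eq_zero (inner_pairMap_swap Ψ) _
  have ho := orthonormal_iff_ite.1 φ.orthonormal
  have hcut1 : ∀ {l a₁ a₂ a b b₁ b₂ : ℕ}, a₁ < a₂ → a₂ < l → a < l → l ≤ b → l ≤ b₁ → b₁ < b₂ →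
      C a₁ a₂ * C a b * C b₁ b₂ = 0 := mul_mul_eq_zero_of_mem_halfInfiniteMPS hr hΨ
  have hcut2 : ∀ {l a₁ a₂ a a' b b' : ℕ}, a₁ < a₂ → a₂ < l → a < l → a' < l → l ≤ b → l ≤ b' →
      C a₁ a₂ * (C a b * C a' b' - C a b' * C a' b) = 0 :=
    mul_minor_eq_zero_of_mem_halfInfiniteMPS hr hΨ
  by_cases hzero : ∀ i j, C i j = 0
  · refine ⟨0, fun i => ?_⟩
    have : pairMap Ψ (φ i) = 0 := hilbertBasis_ext_inner φ fun j => by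
      rw [inner_zero_right]; exact hzero i j
    rw [this]
    exact Submodule.zero_mem _
  have hex : ∃ q, ∃ a < q, C a q ≠ 0 := by
    push Not at hzero
    obtain ⟨i, j, hij⟩ := hzero
    rcases lt_trichotomy i j with h | rfl | h
    · exact ⟨j, i, h, hij⟩
    · exact absurd (hdiag i) hij
    · exact ⟨i, j, h, by rw [hanti] at hij; exact neg_ne_zero.1 hij⟩
  -- `q` is the first site closing a pair with nonzero coefficient: `C` vanishes on the sites before
  -- `q`, and every cut to the right of `q` has such a pair on its left.
  obtain ⟨a₀, ha₀, hC₀⟩ := Nat.find_spec hex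
  set q := Nat.find hex with hq
  have hlow : ∀ a a', a < q → a' < q → C a a' = 0 := by
    have key : ∀ a a', a < a' → a' < q → C a a' = 0 := fun a a' haa ha' => by
      by_contra hne
      exact Nat.find_min hex ha' ⟨a, haa, hne⟩
    intro a a' ha ha'
    rcases lt_trichotomy a a' with h | rfl | h
    · exact key a a' h ha'
    · exact hdiag a
    · rw [hanti, key a' a h ha, neg_zero]
  by_cases hBB : ∀ b b', q < b → q < b' → C b b' = 0
  · by_cases hAB : ∀ a b, a ≤ q → q < b → C a b = 0
    -- Here `C` lives in row and column `q` only.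
    · refine ⟨![φ q, pairMap Ψ (φ q), 0, 0], fun i => ?_⟩
      rcases eq_or_ne i q with rfl | hi
      · exact Submodule.subset_span ⟨1, rfl⟩
      · have : pairMap Ψ (φ i) = C i q • φ q := hilbertBasis_ext_inner φ fun j => by
          rw [inner_smul_right, ho]
          change C i j = _
          split_ifs with hj
          · rw [hj, mul_one]
          · rw [mul_zero]
            rcases lt_or_gt_of_ne hi with h | h <;> rcases lt_or_gt_of_ne hj with h' | h'
            · exact hlow i j h h'
            · exact hAB i j h.le h'
            · rw [hanti, hAB j i h'.le h, neg_zero]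
            · exact hBB i j h h'
        rw [this]
        exact Submodule.smul_mem _ _ (Submodule.subset_span ⟨0, rfl⟩)
    · push Not at hAB
      obtain ⟨a₁, b₁, ha₁, hb₁, hne⟩ := hAB
      -- At the cut after `q` the pair `a₀, q` forces the block of entries joining the two sides to
      -- have rank one.
      have hrank : ∀ a b, a ≤ q → q < b → C a b = C a b₁ / C a₁ b₁ * C a₁ b := by
        intro a b ha hb
        have h := hcut2 (l := q + 1) ha₀ (Nat.lt_succ_self q) (Nat.lt_succ_of_le ha)
          (Nat.lt_succ_of_le ha₁) (Nat.succ_le_of_lt hb) (Nat.succ_le_of_lt hb₁)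
        have h' := (mul_eq_zero.1 h).resolve_left hC₀
        field_simp
        linear_combination h'
      -- The part of row `a₁` beyond `q`, which spans the rows of the rank-one block.
      let w : H := pairMap Ψ (φ a₁) - ∑ j ∈ Finset.range (q + 1), C a₁ j • φ j
      have hw : ∀ j, ⟪φ j, w⟫_ℂ = if j ≤ q then 0 else C a₁ j := by
        intro j
        simp only [w, inner_sub_right, inner_sum, inner_smul_right, ho]
        change C a₁ j - _ = _
        split_ifs with hj
        · simp [Nat.lt_succ_of_le hj]
        · simp [show ¬ j < q + 1 by omega]
      refine ⟨![φ q, pairMap Ψ (φ q), w, pairMap Ψ (φ b₁)], fun i => ?_⟩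
      rcases lt_trichotomy i q with hi | hi | hi
      · have : pairMap Ψ (φ i) = C i q • φ q + (C i b₁ / C a₁ b₁) • w :=
          hilbertBasis_ext_inner φ fun j => by
            rw [inner_add_right, inner_smul_right, inner_smul_right, ho, hw]
            change C i j = _
            rcases lt_trichotomy j q with hj | hj | hj
            · rw [hlow i j hi hj, if_neg hj.ne, if_pos hj.le]; simp
            · subst hj; simp
            · rw [if_neg hj.ne', if_neg (by omega), hrank i j hi.le hj]; simp
        rw [this]
        exact Submodule.add_mem _ (Submodule.smul_mem _ _ (Submodule.subset_span ⟨0, rfl⟩))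
          (Submodule.smul_mem _ _ (Submodule.subset_span ⟨2, rfl⟩))
      · rw [hi]; exact Submodule.subset_span ⟨1, rfl⟩
      · have : pairMap Ψ (φ i) = (C a₁ i / C a₁ b₁) • pairMap Ψ (φ b₁) :=
          hilbertBasis_ext_inner φ fun j => by
            rw [inner_smul_right]
            change C i j = _ * C b₁ j
            rcases le_or_gt j q with hj | hj
            · rw [hanti i j, hanti b₁ j, hrank j i hj hi]
              ring
            · rw [hBB i j hi hj, hBB b₁ j hb₁ hj, mul_zero]
        rw [this]
        exact Submodule.smul_mem _ _ (Submodule.subset_span ⟨3, rfl⟩)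
  · have hBB' : ∃ b b', q < b ∧ b < b' ∧ C b b' ≠ 0 := by
      push Not at hBB
      obtain ⟨b, b', hb, hb', hne⟩ := hBB
      rcases lt_trichotomy b b' with h | rfl | h
      · exact ⟨b, b', hb, h, hne⟩
      · exact absurd (hdiag b) hne
      · exact ⟨b', b, hb', h, by rw [hanti] at hne; exact neg_ne_zero.1 hne⟩
    -- A cut with nonzero pairs on both sides cannot be crossed by a third one.
    have hdec : ∀ {l a b b₁ b₂ : ℕ}, q < l → a < l → l ≤ b → l ≤ b₁ → b₁ < b₂ → C b₁ b₂ ≠ 0 →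
        C a b = 0 := fun hl ha hb hb₁ hb₂ hne => by
      have h := (mul_eq_zero.1 (hcut1 ha₀ hl ha hb hb₁ hb₂)).resolve_right hne
      exact (mul_eq_zero.1 h).resolve_left hC₀
    have hbdd : ∃ M, ∀ b b', M < b → b < b' → C b b' = 0 := by
      by_contra! hunb
      obtain ⟨b, b', hb, hbb', hne⟩ := hBB'
      obtain ⟨c, c', hc, hcc', hne'⟩ := hunb b'
      exact hne (hdec (hb.trans hbb') hbb' le_rfl hc.le hcc' hne')
    -- `m` is the last site that opens a nonzero pair. It is the mirror image of `q`: every cut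
    -- after `q` and up to `m` has pairs on both sides.
    obtain ⟨m, hm, hmax⟩ : ∃ m, (∃ b', q < m ∧ m < b' ∧ C m b' ≠ 0) ∧
        ∀ b b', m < b → b < b' → C b b' = 0 := by
      have hspec := Nat.find_spec hbdd
      set M := Nat.find hbdd with hM
      obtain ⟨b, b', hb, hbb', hne⟩ := hBB'
      have hbM : b ≤ M := by
        by_contra hlt
        exact hne (hspec b b' (not_le.1 hlt) hbb')
      refine ⟨M, ?_, hspec⟩
      have hmin := Nat.find_min hbdd (m := M - 1) (by omega)
      push Not at hmin
      obtain ⟨c, c', hc, hcc', hne'⟩ := hmin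
      have hcM : c = M := by
        by_contra hcne
        exact hne' (hspec c c' (by omega) hcc')
      subst hcM
      exact ⟨c', by omega, hcc', hne'⟩
    obtain ⟨m', hqm, hmm', hnem⟩ := hm
    -- The remaining entries lie before `q`, after `m`, or cross one of the cuts at `b` or `m`; thus
    -- `C` lives in the rows and columns `q` and `m`.
    have hsupp : ∀ a b, a < b → b ≠ q → a ≠ m → C a b = 0 := by
      intro a b hab hbq ham
      rcases lt_or_gt_of_ne hbq with hb | hb
      · exact hlow a b (hab.trans hb) hb
      rcases le_or_gt b m with hbm | hbm
      · exact hdec hb hab le_rfl hbm hmm' hnem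
      rcases lt_or_gt_of_ne ham with ha | ha
      · exact hdec hqm ha hbm.le le_rfl hmm' hnem
      · exact hmax a b ha hab
    refine ⟨![φ q, pairMap Ψ (φ q), φ m, pairMap Ψ (φ m)], fun i => ?_⟩
    rcases eq_or_ne i q with rfl | hiq
    · exact Submodule.subset_span ⟨1, rfl⟩
    rcases eq_or_ne i m with rfl | him
    · exact Submodule.subset_span ⟨3, rfl⟩
    have : pairMap Ψ (φ i) = C i q • φ q + C i m • φ m := hilbertBasis_ext_inner φ fun j => by
      rw [inner_add_right, inner_smul_right, inner_smul_right, ho, ho]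
      change C i j = _
      rcases eq_or_ne j q with rfl | hjq
      · simp [hqm.ne]
      rcases eq_or_ne j m with rfl | hjm
      · simp [hqm.ne']
      rw [if_neg hjq, if_neg hjm, mul_zero, mul_zero, add_zero]
      rcases lt_trichotomy i j with h | rfl | h
      · exact hsupp i j h hjq him
      · exact hdiag i
      · rw [hanti, hsupp j i h hiq hjm, neg_zero]
    rw [this]
    exact Submodule.add_mem _ (Submodule.smul_mem _ _ (Submodule.subset_span ⟨0, rfl⟩))
      (Submodule.smul_mem _ _ (Submodule.subset_span ⟨2, rfl⟩))

/-- The operator of this vector exchanges the members of each pair up to sign, so its range contains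
six independent vectors. -/
theorem not_mem_halfInfiniteMPS_three_pairs (e : HilbertBasis ℕ ℂ H) (φ : HilbertBasis ℕ ℂ H)
    {r : ℕ → ℕ} (hr : ∀ i, r i ≤ 2) :
    inSector 2 (wedge ![e 0, e 1] + wedge ![e 2, e 3] + wedge ![e 4, e 5])
      ∉ halfInfiniteMPS r φ := by
  intro h
  obtain ⟨v, hv⟩ := exists_span_four_of_mem_halfInfiniteMPS hr h
  have ho := orthonormal_iff_ite.1 e.orthonormal
  have hmem : ∀ i : Fin 6, e i ∈ Submodule.span ℂ (Set.range v) := by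
    intro i
    have h' := fun k => hv (e k)
    simp only [pairMap_add, add_apply, pairMap_wedge, ho] at h'
    have h0 := h' 0
    have h1 := h' 1
    have h2 := h' 2
    have h3 := h' 3
    have h4 := h' 4
    have h5 := h' 5
    simp at h0 h1 h2 h3 h4 h5
    fin_cases i
    · exact h1
    · exact h0
    · exact h3
    · exact h2
    · exact h5
    · exact h4
  have hli : LinearIndependent ℂ fun i : Fin 6 => e i :=
    (e.orthonormal.comp _ Fin.val_injective).linearIndependent
  have := FiniteDimensional.span_of_finite ℂ (Set.finite_range v)
  have h6 : LinearIndependent ℂ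
      fun i : Fin 6 => (⟨e i, hmem i⟩ : Submodule.span ℂ (Set.range v)) :=
    LinearIndependent.of_comp (Submodule.span ℂ (Set.range v)).subtype hli
  have hcard := h6.fintype_card_le_finrank.trans (finrank_range_le_card v)
  simp at hcard

end RangeBound

end

end FermionFock

theorem theorem4 {H : Type*} [NormedAddCommGroup H] [InnerProductSpace ℂ H] [CompleteSpace H]
    [TopologicalSpace.SeparableSpace H] (hH : ¬ FiniteDimensional ℂ H) :
    -- bond dimensions `2, 2, 3, 2, 3, 2, …` unless the kernel of `γ_Ψ` has finite odd dimension
    (∀ Ψ : FermionFock.AntisymPower H 2,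
      ¬ Odd (Module.finrank ℂ (LinearMap.ker (FermionFock.densityMatrix Ψ))) →
      ∃ φ : HilbertBasis ℕ ℂ H, FermionFock.IsNaturalBasis φ Ψ ∧
        FermionFock.inSector 2 Ψ ∈
          FermionFock.halfInfiniteMPS (fun i => if Odd i ∧ 1 < i then 3 else 2) φ) ∧
    -- in the remaining case the same bond dimensions, shifted by one site: `1, 2, 2, 3, 2, 3, …`
    (∀ Ψ : FermionFock.AntisymPower H 2,
      Odd (Module.finrank ℂ (LinearMap.ker (FermionFock.densityMatrix Ψ))) →
      ∃ φ : HilbertBasis ℕ ℂ H, FermionFock.IsNaturalBasis φ Ψ ∧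
        FermionFock.inSector 2 Ψ ∈
          FermionFock.halfInfiniteMPS
            (fun i => if i = 1 then 1 else if Even i ∧ 2 < i then 3 else 2) φ) ∧
    -- in particular, maximal bond dimension three suffices for every two-particle state
    (∀ Ψ : FermionFock.AntisymPower H 2,
      ∃ φ : HilbertBasis ℕ ℂ H, FermionFock.IsNaturalBasis φ Ψ ∧
        ∃ r : ℕ → ℕ, (∀ i, r i ≤ 3) ∧
          FermionFock.inSector 2 Ψ ∈ FermionFock.halfInfiniteMPS r φ) ∧
    -- bond dimension two does not suffice
    ∃ Ψ : FermionFock.AntisymPower H 2,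
      ∀ (φ : HilbertBasis ℕ ℂ H) (r : ℕ → ℕ), (∀ i, r i ≤ 2) →
        FermionFock.inSector 2 Ψ ∉ FermionFock.halfInfiniteMPS r φ := by
  -- Both parities are treated at once: `p` is the number of leading sites with an unpaired kernel
  -- vector.
  have main : ∀ Ψ : FermionFock.AntisymPower H 2, ∀ p,
      Module.finrank ℂ (LinearMap.ker (FermionFock.densityMatrix Ψ)) % 2 = p →
      ∃ φ : HilbertBasis ℕ ℂ H, FermionFock.IsNaturalBasis φ Ψ ∧ ∀ r : ℕ → ℕ,
        (∀ i ≤ p, FermionFock.bond r i = 1) → FermionFock.bond r (p + 1) = 2 →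
        (∀ m, FermionFock.bond r (p + 2 * (m + 1)) = 2) →
        (∀ m, FermionFock.bond r (p + 2 * (m + 1) + 1) = 3) →
        FermionFock.inSector 2 Ψ ∈ FermionFock.halfInfiniteMPS r φ := by
    intro Ψ p hp
    have hker : LinearMap.ker (FermionFock.densityMatrix Ψ)
        = LinearMap.ker (FermionFock.pairMap Ψ).toLinearMap := by
      ext f; exact FermionFock.densityMatrix_eq_zero_iff Ψ f
    rw [hker] at hp
    obtain ⟨φ, c, h0, h1, h2⟩ := FermionFock.exists_hilbertBasis_pairs hH
      (FermionFock.inner_pairMap_swap Ψ) (FermionFock.isCompactOperator_pairMap Ψ) p hp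
    refine ⟨φ, fun i => ?_, fun r hb0 hb1 hbe hbo =>
      FermionFock.inSector_mem_halfInfiniteMPS hb0 hb1 hbe hbo φ
        (FermionFock.hasSum_pairs φ Ψ p c h0 h1 h2)⟩
    rcases lt_or_ge i p with hi | hi
    · exact ⟨0, by rw [FermionFock.densityMatrix_apply, h0 i hi]; simp⟩
    · obtain ⟨n, rfl⟩ := Nat.exists_eq_add_of_le hi
      rcases Nat.even_or_odd' n with ⟨k, rfl | rfl⟩
      · refine ⟨c k ^ 2, ?_⟩
        rw [FermionFock.densityMatrix_apply, h1, map_smulₛₗ, h2, smul_smul, ← neg_smul]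
        congr 1
        simp [sq]
      · refine ⟨c k ^ 2, ?_⟩
        rw [FermionFock.densityMatrix_apply, ← add_assoc, h2, map_smulₛₗ, h1, smul_smul,
          ← neg_smul]
        congr 1
        simp [sq]
  have even_case : ∀ Ψ : FermionFock.AntisymPower H 2,
      ¬ Odd (Module.finrank ℂ (LinearMap.ker (FermionFock.densityMatrix Ψ))) →
      ∃ φ : HilbertBasis ℕ ℂ H, FermionFock.IsNaturalBasis φ Ψ ∧
        FermionFock.inSector 2 Ψ ∈
          FermionFock.halfInfiniteMPS (fun i => if Odd i ∧ 1 < i then 3 else 2) φ := by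
    intro Ψ hΨ
    obtain ⟨φ, hφ, h⟩ := main Ψ 0 (Nat.even_iff.1 (Nat.not_odd_iff_even.1 hΨ))
    refine ⟨φ, hφ, h _ ?_ ?_ ?_ ?_⟩
    · intro i hi
      obtain rfl := Nat.le_zero.1 hi
      rfl
    · simp [FermionFock.bond]
    · intro m
      rw [show 0 + 2 * (m + 1) = (2 * m + 1) + 1 by ring]
      simp [FermionFock.bond, Nat.odd_iff, Nat.add_mod]
    · intro m
      simp [FermionFock.bond]
  have odd_case : ∀ Ψ : FermionFock.AntisymPower H 2,
      Odd (Module.finrank ℂ (LinearMap.ker (FermionFock.densityMatrix Ψ))) →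
      ∃ φ : HilbertBasis ℕ ℂ H, FermionFock.IsNaturalBasis φ Ψ ∧
        FermionFock.inSector 2 Ψ ∈ FermionFock.halfInfiniteMPS
          (fun i => if i = 1 then 1 else if Even i ∧ 2 < i then 3 else 2) φ := by
    intro Ψ hΨ
    obtain ⟨φ, hφ, h⟩ := main Ψ 1 (Nat.odd_iff.1 hΨ)
    refine ⟨φ, hφ, h _ ?_ ?_ ?_ ?_⟩
    · intro i hi
      rcases i with _ | i
      · rfl
      · obtain rfl : i = 0 := by omega
        rfl
    · simp [FermionFock.bond]
    · intro m
      rw [show 1 + 2 * (m + 1) = (2 * m + 2) + 1 by ring]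
      simp [FermionFock.bond, Nat.even_iff, Nat.add_mod]
    · intro m
      rw [show 1 + 2 * (m + 1) + 1 = (2 * m + 3) + 1 by ring]
      simp [FermionFock.bond, Nat.even_iff, Nat.add_mod]
  refine ⟨even_case, odd_case, fun Ψ => ?_, ?_⟩
  · by_cases hΨ : Odd (Module.finrank ℂ (LinearMap.ker (FermionFock.densityMatrix Ψ)))
    · obtain ⟨φ, hφ, h⟩ := odd_case Ψ hΨ
      exact ⟨φ, hφ, _, fun i => by split_ifs <;> norm_num, h⟩
    · obtain ⟨φ, hφ, h⟩ := even_case Ψ hΨ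
      exact ⟨φ, hφ, _, fun i => by split_ifs <;> norm_num, h⟩
  -- Only some orthonormal basis indexed by `ℕ` is needed; natural orbitals of the zero vector
  -- provide one.
  · obtain ⟨e, -⟩ := main 0 _ rfl
    exact ⟨_, fun φ r hr => FermionFock.not_mem_halfInfiniteMPS_three_pairs e φ hr⟩
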